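/- Let $n\ge 3$. Let $B_n$ be the Artin braid group, generated by $\sigma_1,\dots,\sigma_{n-1}$ subject to the Artin relations $\sigma_i\sigma_j=\sigma_j\sigma_i$ for $|i-j|\ge 2$ and $\sigma_{i+1}\sigma_i\sigma_{i+1}=\sigma_i\sigma_{i+1}\sigma_i$ for $1\le i\le n-2$. Let $P_n$ be the pure braid group, that is, the kernel of the homomorphism $B_n\to S_n$, $\sigma_i\mapsto (i,i+1)$. Put $[g,h]=ghg^{-1}h^{-1}$, $\Gamma_1(P_n)=P_n$ and $\Gamma_{i+1}(P_n)=[P_n,\Gamma_i(P_n)]$. For $1\le i<j\le n$ let $$A_{i,j}=A_{j,i}=\sigma_{j-1}\cdots\sigma_{i+1}\sigma_i^2\sigma_{i+1}^{-1}\cdots\sigma_{j-1}^{-1}\in P_n,$$ and for $1\le r<s<t\le n$ let $\alpha_{r,s,t}=[A_{r,s},A_{s,t}]$. The same symbols denote the classes of these elements modulo $\Gamma_3(P_n)$. We write $\sigma_k(i)$ for the image of $i$ under the transposition $(k,k+1)$. (a) The group $P_n/\Gamma_3(P_n)$ has a presentation with generators $A_{i,j}$ ($1\le i<j\le n$) and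 $\alpha_{r,s,t}$ ($1\le r<s<t\le n$), and relations: (i) the $\alpha_{r,s,t}$ commute pairwise and with the $A_{i,j}$; (ii) for $i<j<m$: $[A_{i,j},A_{j,m}]=\alpha_{i,j,m}$, $[A_{i,j},A_{i,m}]=\alpha_{i,j,m}^{-1}$ and $[A_{i,m},A_{j,m}]=\alpha_{i,j,m}^{-1}$; and $[A_{i,j},A_{l,m}]=1$ for $i<j$, $l<m$ whenever $\{i,j,l,m\}$ has $2$ or $4$ elements. (b) The group $B_n/\Gamma_3(P_n)$ has a presentation with generators $\sigma_k$ ($1\le k\le n-1$), $A_{i,j}$ ($1\le i<j\le n$) and $\alpha_{r,s,t}$ ($1\le r<s<t\le n$), and relations: (i) the relations (i) and (ii) of (a); (ii) the Artin relations between the $\sigma_k$, and $\sigma_k^2=A_{k,k+1}$ for $1\le k\le n-1$; (iii) for $1\le k\le n-1$ and $1\le r<s<t\le n$, $$\sigma_k\alpha_{r,s,t}\sigma_k^{-1}=\begin{cases}\alpha_{\sigma_k(r),\sigma_k(s),\sigma_k(t)}&\text{if }\sigma_k(r)<\sigma_k(s)<\sigma_k(t),\\ \alpha_{\sigma_k(s),\sigma_k(r),\sigma_k(t)}^{-1}&\text{if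 }\sigma_k(r)>\sigma_k(s),\\ \alpha_{\sigma_k(r),\sigma_k(t),\sigma_k(s)}^{-1}&\text{if }\sigma_k(s)>\sigma_k(t);\end{cases}$$ (iv) for $1\le k\le n-1$ and $1\le i<j\le n$, $$\sigma_kA_{i,j}\sigma_k^{-1}=\begin{cases}A_{i,j-1}\,\alpha_{i,j-1,j}^{-1}&\text{if }j=k+1\text{ and }i<k,\\ A_{i-1,j}\,\alpha_{i-1,i,j}^{-1}&\text{if }i=k+1,\\ A_{\sigma_k(i),\sigma_k(j)}&\text{otherwise.}\end{cases}$$ In both presentations each generator stands for the class of the braid denoted by the same symbol. -/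

import Mathlib

open scoped commutatorElement

namespace BraidNil

/-! Strands are numbered `0, …, n - 1` (elements of `Fin n`) and the Artin generators are numbered
`0, …, n - 2` (elements of `Fin (n - 1)`): the generator with number `k` exchanges the strands
`k` and `k + 1`. This is the usual numbering `1, …, n`, shifted by one. -/

/-- The strand `k`, for an Artin generator with number `k`. -/
def lo {n : ℕ} (k : Fin (n - 1)) : Fin n := ⟨k.val, by omega⟩

/-- The strand `k + 1`, for an Artin generator with number `k`. -/
def hi {n : ℕ} (k : Fin (n - 1)) : Fin n := ⟨k.val + 1, by omega⟩

/-- The transposition `(k, k + 1)` of the strands. -/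
def adjSwap {n : ℕ} (k : Fin (n - 1)) : Equiv.Perm (Fin n) := Equiv.swap (lo k) (hi k)

/-- The group `G` has the presentation with generators `x : X` and relators `rels`, where the
generator `x` stands for the element `f x` of `G`: the elements `f x` generate `G`, and a word is
trivial in `G` precisely if it lies in the normal closure of the relators. -/
def IsPresentation {X G : Type*} [Group G] (rels : Set (FreeGroup X)) (f : X → G) : Prop :=
  Function.Surjective (FreeGroup.lift f) ∧
    (FreeGroup.lift f).ker = Subgroup.normalClosure rels

/-- The relators `u v⁻¹` that correspond to a set of equations `u = v` between words. -/
def relators {X : Type*} (E : FreeGroup X → FreeGroup X → Prop) : Set (FreeGroup X) :=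
  {w | ∃ u v, E u v ∧ w = u * v⁻¹}

/-! ### Braid groups -/

/-- The Artin braid relations, as equations between words in the Artin generators. -/
inductive ArtinRel (n : ℕ) : FreeGroup (Fin (n - 1)) → FreeGroup (Fin (n - 1)) → Prop
  | comm (i j : Fin (n - 1)) (h : i.val + 2 ≤ j.val) :
      ArtinRel n (FreeGroup.of i * FreeGroup.of j) (FreeGroup.of j * FreeGroup.of i)
  | braid (i j : Fin (n - 1)) (h : j.val = i.val + 1) :
      ArtinRel n (FreeGroup.of j * FreeGroup.of i * FreeGroup.of j)
        (FreeGroup.of i * FreeGroup.of j * FreeGroup.of i)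

/-- The Artin braid group on `n` strands. -/
abbrev BraidGroup (n : ℕ) : Type := PresentedGroup (relators (ArtinRel n))

/-- The Artin generators of the braid group. -/
def sigma {n : ℕ} (k : Fin (n - 1)) : BraidGroup n := PresentedGroup.of k

theorem adjSwap_comm {n : ℕ} (i j : Fin (n - 1)) (h : i.val + 2 ≤ j.val) :
    adjSwap i * adjSwap j = adjSwap j * adjSwap i := by
  apply Equiv.Perm.Disjoint.commute
  intro x
  by_cases hx : x = lo i ∨ x = hi i
  · right
    apply Equiv.swap_apply_of_ne_of_ne
    all_goals
      rcases hx with rfl | rfl <;> simp only [lo, hi, ne_eq, Fin.mk.injEq] <;> omega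
  · left
    push Not at hx
    exact Equiv.swap_apply_of_ne_of_ne hx.1 hx.2

theorem adjSwap_braid {n : ℕ} (i j : Fin (n - 1)) (h : j.val = i.val + 1) :
    adjSwap j * adjSwap i * adjSwap j = adjSwap i * adjSwap j * adjSwap i := by
  have e : lo j = hi i := by simp [lo, hi, h]
  have h1 : lo i ≠ hi i := by simp [lo, hi]
  have h2 : lo i ≠ hi j := by simp only [lo, hi, ne_eq, Fin.mk.injEq]; omega
  have h3 : hi i ≠ hi j := by simp only [hi, ne_eq, Fin.mk.injEq]; omega
  unfold adjSwap
  rw [e]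
  have a := Equiv.swap_mul_swap_mul_swap (x := hi j) (y := hi i) (z := lo i) h3.symm h2.symm
  have b := Equiv.swap_mul_swap_mul_swap (x := lo i) (y := hi i) (z := hi j) h1 h2
  rw [Equiv.swap_comm (hi i) (hi j), Equiv.swap_comm (lo i) (hi i)]
  rw [Equiv.swap_comm (hi i) (hi j), Equiv.swap_comm (lo i) (hi i)] at b
  exact b.trans ((Equiv.swap_comm _ _).trans a.symm)

/-- The homomorphism from the braid group to the symmetric group that sends the `k`th Artin
generator to the transposition `(k, k + 1)`. -/
def permHom (n : ℕ) : BraidGroup n →* Equiv.Perm (Fin n) :=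
  PresentedGroup.toGroup (f := adjSwap) (by
    rintro w ⟨u, v, h, rfl⟩
    cases h with
    | comm i j h => simp [adjSwap_comm i j h]
    | braid i j h => simp [adjSwap_braid i j h])

/-- The pure braid group `P_n`, a subgroup of `B_n`. -/
def pureBraid (n : ℕ) : Subgroup (BraidGroup n) := (permHom n).ker

instance (n : ℕ) : (pureBraid n).Normal := by unfold pureBraid; infer_instance

/-- The third term `Γ₃(P_n) = [P_n, [P_n, P_n]]` of the lower central series of `P_n`, where
`Γ₁(P_n) = P_n`. It is a normal subgroup of `B_n` contained in `P_n`. -/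
def gammaThree (n : ℕ) : Subgroup (BraidGroup n) := (pureBraid n).lowerCentralSeries 2

instance (n : ℕ) : (gammaThree n).Normal := by unfold gammaThree; infer_instance

/-- The group `B_n / Γ₃(P_n)`. -/
abbrev BraidQuotient (n : ℕ) : Type := BraidGroup n ⧸ gammaThree n

/-- The group `P_n / Γ₃(P_n)`. -/
abbrev PureQuotient (n : ℕ) : Type := pureBraid n ⧸ (gammaThree n).subgroupOf (pureBraid n)

/-! ### The elements `A_{i,j}` and `α_{r,s,t}` -/

/-- The braid `A_{i,j} = σ_{j-1} ⋯ σ_{i+1} σ_i² σ_{i+1}⁻¹ ⋯ σ_{j-1}⁻¹`, for `i < j < n`. -/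
def braidAux {n : ℕ} (i : ℕ) : (j : ℕ) → i < j → j < n → BraidGroup n
  | 0, h, _ => absurd h (Nat.not_lt_zero i)
  | j + 1, h, hn =>
      if e : i = j then sigma (⟨j, by omega⟩ : Fin (n - 1)) ^ 2
      else sigma (⟨j, by omega⟩ : Fin (n - 1)) * braidAux i j (by omega) (by omega) *
        (sigma (⟨j, by omega⟩ : Fin (n - 1)))⁻¹

theorem braidAux_mem {n : ℕ} (i : ℕ) :
    ∀ (j : ℕ) (h : i < j) (hn : j < n), braidAux i j h hn ∈ pureBraid n
  | 0, h, _ => absurd h (Nat.not_lt_zero i)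
  | j + 1, h, hn => by
      unfold braidAux
      split_ifs with e
      · simp [pureBraid, MonoidHom.mem_ker, permHom, sigma, adjSwap, sq]
      · exact (inferInstance : (pureBraid n).Normal).conj_mem _
          (braidAux_mem i j (by omega) (by omega)) _

/-- The element `A_{i,j}` of `P_n`. -/
def pureA {n : ℕ} (i j : Fin n) (h : i < j) : pureBraid n :=
  ⟨braidAux i.val j.val h j.isLt, braidAux_mem i.val j.val h j.isLt⟩

/-- The element `α_{r,s,t} = [A_{r,s}, A_{s,t}]` of `P_n`, where `[g, h] = g h g⁻¹ h⁻¹`. -/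
def pureAlpha {n : ℕ} (r s t : Fin n) (hrs : r < s) (hst : s < t) : pureBraid n :=
  ⁅pureA r s hrs, pureA s t hst⁆

/-! ### The presentation of `P_n / Γ₃(P_n)` -/

/-- The generators `A_{i,j}` for `i < j`, and `α_{r,s,t}` for `r < s < t`, as formal symbols. -/
inductive PureGen (n : ℕ) : Type
  | A (i j : Fin n) (h : i < j) : PureGen n
  | alpha (r s t : Fin n) (hrs : r < s) (hst : s < t) : PureGen n

/-- The element of `P_n` for which a generator stands. -/
def PureGen.elt {n : ℕ} : PureGen n → pureBraid n
  | .A i j h => pureA i j h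
  | .alpha r s t hrs hst => pureAlpha r s t hrs hst

/-- The one-letter word `A_{i,j}`. -/
def wA {n : ℕ} (i j : Fin n) (h : i < j) : FreeGroup (PureGen n) := FreeGroup.of (.A i j h)

/-- The one-letter word `α_{r,s,t}`. -/
def wAlpha {n : ℕ} (r s t : Fin n) (hrs : r < s) (hst : s < t) : FreeGroup (PureGen n) :=
  FreeGroup.of (.alpha r s t hrs hst)

/-- The relations of `P_n / Γ₃(P_n)`, as equations between words. -/
inductive PureRel (n : ℕ) : FreeGroup (PureGen n) → FreeGroup (PureGen n) → Prop
  | alpha_alpha (r s t r' s' t' : Fin n) (hrs : r < s) (hst : s < t)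
      (hrs' : r' < s') (hst' : s' < t') :
      PureRel n (wAlpha r s t hrs hst * wAlpha r' s' t' hrs' hst')
        (wAlpha r' s' t' hrs' hst' * wAlpha r s t hrs hst)
  | alpha_A (r s t i j : Fin n) (hrs : r < s) (hst : s < t) (hij : i < j) :
      PureRel n (wAlpha r s t hrs hst * wA i j hij) (wA i j hij * wAlpha r s t hrs hst)
  | chain (i j m : Fin n) (hij : i < j) (hjm : j < m) :
      PureRel n ⁅wA i j hij, wA j m hjm⁆ (wAlpha i j m hij hjm)
  | left (i j m : Fin n) (hij : i < j) (hjm : j < m) :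
      PureRel n ⁅wA i j hij, wA i m (hij.trans hjm)⁆ (wAlpha i j m hij hjm)⁻¹
  | right (i l m : Fin n) (hil : i < l) (hlm : l < m) :
      PureRel n ⁅wA i m (hil.trans hlm), wA l m hlm⁆ (wAlpha i l m hil hlm)⁻¹
  | trivial (i j l m : Fin n) (hij : i < j) (hlm : l < m)
      (hc : ({i, j, l, m} : Finset (Fin n)).card = 2 ∨
        ({i, j, l, m} : Finset (Fin n)).card = 4) :
      PureRel n ⁅wA i j hij, wA l m hlm⁆ 1

/-! ### The presentation of `B_n / Γ₃(P_n)` -/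

/-- The generators `σ_k`, `A_{i,j}` and `α_{r,s,t}`, as formal symbols. -/
inductive BraidGen (n : ℕ) : Type
  | sigma (k : Fin (n - 1)) : BraidGen n
  | pure (g : PureGen n) : BraidGen n

/-- The element of `B_n` for which a generator stands. -/
def BraidGen.elt {n : ℕ} : BraidGen n → BraidGroup n
  | .sigma k => BraidNil.sigma k
  | .pure g => (g.elt : BraidGroup n)

/-- Words in the Artin generators, as words in all the generators. -/
def ofArtin {n : ℕ} : FreeGroup (Fin (n - 1)) →* FreeGroup (BraidGen n) :=
  FreeGroup.map BraidGen.sigma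

/-- Words in the `A_{i,j}` and `α_{r,s,t}`, as words in all the generators. -/
def ofPure {n : ℕ} : FreeGroup (PureGen n) →* FreeGroup (BraidGen n) :=
  FreeGroup.map BraidGen.pure

/-- The one-letter word `σ_k`. -/
def bSigma {n : ℕ} (k : Fin (n - 1)) : FreeGroup (BraidGen n) := FreeGroup.of (.sigma k)

/-- The one-letter word `A_{i,j}`, for `i < j`. -/
def bA {n : ℕ} (i j : Fin n) (h : i < j) : FreeGroup (BraidGen n) :=
  FreeGroup.of (.pure (.A i j h))

/-- The one-letter word `A_{i,j}` for `i ≠ j`, with the convention `A_{j,i} = A_{i,j}`. -/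
def bAsymm {n : ℕ} (i j : Fin n) (h : i ≠ j) : FreeGroup (BraidGen n) :=
  if hij : i < j then bA i j hij else bA j i (lt_of_le_of_ne (not_lt.mp hij) h.symm)

/-- The one-letter word `α_{r,s,t}`. -/
def bAlpha {n : ℕ} (r s t : Fin n) (hrs : r < s) (hst : s < t) : FreeGroup (BraidGen n) :=
  FreeGroup.of (.pure (.alpha r s t hrs hst))

/-- The relations of `B_n / Γ₃(P_n)`, as equations between words. In `alpha_swap_left` and
`alpha_swap_right`, one of the two inequalities decides the case; the other one then holds
automatically and only serves to write the index of `α` in increasing order. -/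
inductive BraidRel (n : ℕ) : FreeGroup (BraidGen n) → FreeGroup (BraidGen n) → Prop
  | pure (u v : FreeGroup (PureGen n)) (h : PureRel n u v) : BraidRel n (ofPure u) (ofPure v)
  | artin (u v : FreeGroup (Fin (n - 1))) (h : ArtinRel n u v) :
      BraidRel n (ofArtin u) (ofArtin v)
  | sigma_sq (k : Fin (n - 1)) (h : lo k < hi k) :
      BraidRel n (bSigma k ^ 2) (bA (lo k) (hi k) h)
  | alpha_keep (k : Fin (n - 1)) (r s t : Fin n) (hrs : r < s) (hst : s < t)
      (h₁ : adjSwap k r < adjSwap k s) (h₂ : adjSwap k s < adjSwap k t) :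
      BraidRel n (bSigma k * bAlpha r s t hrs hst * (bSigma k)⁻¹)
        (bAlpha (adjSwap k r) (adjSwap k s) (adjSwap k t) h₁ h₂)
  | alpha_swap_left (k : Fin (n - 1)) (r s t : Fin n) (hrs : r < s) (hst : s < t)
      (h₁ : adjSwap k s < adjSwap k r) (h₂ : adjSwap k r < adjSwap k t) :
      BraidRel n (bSigma k * bAlpha r s t hrs hst * (bSigma k)⁻¹)
        (bAlpha (adjSwap k s) (adjSwap k r) (adjSwap k t) h₁ h₂)⁻¹
  | alpha_swap_right (k : Fin (n - 1)) (r s t : Fin n) (hrs : r < s) (hst : s < t)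
      (h₁ : adjSwap k r < adjSwap k t) (h₂ : adjSwap k t < adjSwap k s) :
      BraidRel n (bSigma k * bAlpha r s t hrs hst * (bSigma k)⁻¹)
        (bAlpha (adjSwap k r) (adjSwap k t) (adjSwap k s) h₁ h₂)⁻¹
  | A_right (k : Fin (n - 1)) (i : Fin n) (hi₁ : i < hi k) (hi₂ : i < lo k) (hk : lo k < hi k) :
      BraidRel n (bSigma k * bA i (hi k) hi₁ * (bSigma k)⁻¹)
        (bA i (lo k) hi₂ * (bAlpha i (lo k) (hi k) hi₂ hk)⁻¹)
  | A_left (k : Fin (n - 1)) (j : Fin n) (hj₁ : hi k < j) (hj₂ : lo k < j) (hk : lo k < hi k) :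
      BraidRel n (bSigma k * bA (hi k) j hj₁ * (bSigma k)⁻¹)
        (bA (lo k) j hj₂ * (bAlpha (lo k) (hi k) j hk hj₁)⁻¹)
  | A_other (k : Fin (n - 1)) (i j : Fin n) (hij : i < j)
      (h₁ : ¬ (j = hi k ∧ i < lo k)) (h₂ : i ≠ hi k) (hne : adjSwap k i ≠ adjSwap k j) :
      BraidRel n (bSigma k * bA i j hij * (bSigma k)⁻¹)
        (bAsymm (adjSwap k i) (adjSwap k j) hne)

end BraidNil

/-! Relations hold. The image of `P_n` in `B_n/Γ₃(P_n)` is nilpotent of class two, so a commutator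
there depends only on its entries modulo `Γ₂`. Modulo `Γ₂` a braid conjugates the `A_{i,j}` by
permuting their indices (`conj_barA`). Hence `B_n` acts exactly, through `S_n`, on the commutators
`[A_{i,j}, A_{k,l}]`, and each commutator relation need only be checked on the first three or four
strands (`commutator_barA_triangle`, `commutator_barA_disjoint`). The exceptional cases of (iv) come
from `σ_k A_{i,k+1} σ_k⁻¹ = σ_k² A_{i,k} σ_k⁻²` with `σ_k² = A_{k,k+1}`, and similarly on the other
side.

Generation. `P_n` is the normal closure of the `σ_k²`, since imposing `σ_k² = 1` leaves `S_n`
(`pureBraid_le`). A subgroup of the target that contains the images of the `σ_k²` and is stable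
under conjugation by the `σ_k` therefore contains the image of `P_n`.

Completeness of (a). By its relations the presented group has class two, with commutators in the
central subgroup generated by the `α`. What remains is to detect exponents. This is done by a
homomorphism from `B_n` to an explicit group `Model`: triples of a rational function on pairs, a
rational function on triples and a permutation, multiplied through an alternating bracket that
encodes `[A_{a,b}, A_{b,c}] = [A_{b,c}, A_{c,a}] = [A_{c,a}, A_{a,b}]`. On pure braids it kills
`Γ₃`. The pair coordinates read off the exponents of the `A_{i,j}`; on words in the `α` the triple
coordinates read off the exponents of the `α_{r,s,t}`. A word trivial in the quotient thus first
becomes a word in the `α`, then trivial.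

Completeness of (b). `B_n` maps to the presented group. There the image of `P_n` lies in the image
of the class-two group of (a), so `Γ₃(P_n)` dies, and the resulting map undoes evaluation. -/

namespace BraidNil

/-! ### Sequences satisfying the Artin relations -/

/-- The elements `s 0, …, s (m - 1)` of a group satisfy the Artin relations. -/
structure IsArtin {G : Type*} [Group G] (s : ℕ → G) (m : ℕ) : Prop where
  comm : ∀ i j, i + 2 ≤ j → j < m → s i * s j = s j * s i
  braid : ∀ i, i + 1 < m → s (i + 1) * s i * s (i + 1) = s i * s (i + 1) * s i

section Artin

variable {G : Type*} [Group G] {s : ℕ → G} {m : ℕ}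

theorem IsArtin.commute (h : IsArtin s m) {i j : ℕ} (hij : i + 2 ≤ j ∨ j + 2 ≤ i)
    (hi : i < m) (hj : j < m) : Commute (s i) (s j) := by
  rcases hij with hij | hij
  · exact h.comm i j hij hj
  · exact (h.comm j i hij hi).symm

theorem IsArtin.map {K : Type*} [Group K] (h : IsArtin s m) (f : G →* K) :
    IsArtin (fun i => f (s i)) m :=
  ⟨fun i j hij hj => by simpa using congrArg f (h.comm i j hij hj),
    fun i hi => by simpa using congrArg f (h.braid i hi)⟩

/-- The product `s (j + e - 1) ⋯ s (j + 1) s j`. -/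
def chain (s : ℕ → G) (j : ℕ) : ℕ → G
  | 0 => 1
  | e + 1 => s (j + e) * chain s j e

theorem chain_succ_left (s : ℕ → G) (j e : ℕ) :
    chain s j (e + 1) = chain s (j + 1) e * s j := by
  induction e with
  | zero => simp [chain]
  | succ e ih =>
    rw [chain, ih, chain, mul_assoc, show j + (e + 1) = j + 1 + e by omega]

theorem IsArtin.commute_chain (h : IsArtin s m) {i j e : ℕ} (hij : i + 2 ≤ j ∨ j + e + 1 ≤ i)
    (hi : i < m) (hj : j + e ≤ m) : Commute (s i) (chain s j e) := by
  induction e with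
  | zero => exact Commute.one_right _
  | succ e ih =>
    exact (h.commute (by omega) hi (by omega)).mul_right (ih (by omega) (by omega))

/-- Letters above the index `i + 1` commute with `s i`, and the braid relation does the one
nontrivial exchange. Crossing the chain lowers an index, which lets `exists_chain` absorb a letter
into a smaller subgroup. -/
theorem IsArtin.chain_mul (h : IsArtin s m) {i j e : ℕ} (hij : j ≤ i) (hi : i + 1 < j + e)
    (hj : j + e ≤ m) : chain s j e * s (i + 1) = s i * chain s j e := by
  induction e with
  | zero => omega
  | succ e ih =>
    rcases Nat.lt_or_ge (i + 1) (j + e) with h1 | h1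
    · rw [chain, mul_assoc, ih h1 (by omega), ← mul_assoc,
        (h.commute (i := j + e) (j := i) (by omega) (by omega) (by omega)).eq, mul_assoc]
    · obtain ⟨e, rfl⟩ : ∃ e', e = e' + 1 := ⟨e - 1, by omega⟩
      obtain rfl : i = j + e := by omega
      have hc : Commute (s (j + e + 1)) (chain s j e) :=
        h.commute_chain (by omega) (by omega) (by omega)
      have hb := h.braid (j + e) (by omega)
      simp only [chain, ← add_assoc]
      rw [mul_assoc, mul_assoc, ← hc.eq, ← mul_assoc, ← mul_assoc, hb]
      simp only [mul_assoc]

/-- The subgroup generated by the first `k` elements of a sequence. -/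
def initialSubgroup (s : ℕ → G) (k : ℕ) : Subgroup G := Subgroup.closure {g | ∃ i < k, g = s i}

theorem mem_initialSubgroup {i k : ℕ} (h : i < k) : s i ∈ initialSubgroup s k :=
  Subgroup.subset_closure ⟨i, h, rfl⟩

/-- The chains `s k ⋯ s j` play the role of coset representatives of one symmetric group in the
next: up to a left factor in the smaller subgroup, they are permuted by right multiplication with
the generators. -/
theorem IsArtin.exists_chain (h : IsArtin s m) (hs : ∀ i < m, s i * s i = 1) {k : ℕ} (hk : k < m)
    {g : G} (hg : g ∈ initialSubgroup s (k + 1)) :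
    ∃ d ∈ initialSubgroup s k, ∃ j e, j + e = k + 1 ∧ g = d * chain s j e := by
  have step : ∀ x i, i < k + 1 →
      (∃ d ∈ initialSubgroup s k, ∃ j e, j + e = k + 1 ∧ x = d * chain s j e) →
      ∃ d ∈ initialSubgroup s k, ∃ j e, j + e = k + 1 ∧ x * s i = d * chain s j e := by
    rintro x i hi ⟨d, hd, j, e, hje, rfl⟩
    -- A letter well below the chain commutes past it, one just below extends it, its last letter
    -- cancels, and a higher letter crosses by `chain_mul`.
    rcases lt_trichotomy i j with hij | rfl | hij
    · rcases Nat.lt_or_ge (i + 1) j with h1 | h1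
      · refine ⟨d * s i, mul_mem hd (mem_initialSubgroup (by omega)), j, e, hje, ?_⟩
        rw [mul_assoc, mul_assoc, (h.commute_chain (i := i) (by omega) (by omega) (by omega)).eq]
      · obtain rfl : j = i + 1 := by omega
        exact ⟨d, hd, i, e + 1, by omega, by rw [chain_succ_left, mul_assoc]⟩
    · obtain ⟨e, rfl⟩ : ∃ e', e = e' + 1 := ⟨e - 1, by omega⟩
      refine ⟨d, hd, i + 1, e, by omega, ?_⟩
      rw [chain_succ_left, mul_assoc, mul_assoc, hs i (by omega), mul_one]
    · obtain ⟨i, rfl⟩ : ∃ i', i = i' + 1 := ⟨i - 1, by omega⟩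
      refine ⟨d * s i, mul_mem hd (mem_initialSubgroup (by omega)), j, e, hje, ?_⟩
      rw [mul_assoc, h.chain_mul (by omega) (by omega) (by omega), mul_assoc]
  induction hg using Subgroup.closure_induction_right with
  | one => exact ⟨1, one_mem _, k + 1, 0, rfl, by simp [chain]⟩
  | mul_right x hx y hy ih =>
    obtain ⟨i, hi, rfl⟩ := hy
    exact step x i hi ih
  | mul_inv_cancel x hx y hy ih =>
    obtain ⟨i, hi, rfl⟩ := hy
    rw [inv_eq_of_mul_eq_one_left (hs i (by omega))]
    exact step x i hi ih

/-- A group generated by involutions that satisfy the Artin relations acts faithfully on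
points which the generators exchange like adjacent transpositions. -/
theorem IsArtin.eq_one_of_perm (h : IsArtin s m) (hs : ∀ i < m, s i * s i = 1)
    {X : Type*} (p : G →* Equiv.Perm X) (x : ℕ → X)
    (hx : ∀ i ≤ m, ∀ j ≤ m, x i = x j → i = j)
    (hp : ∀ i < m, p (s i) (x i) = x (i + 1))
    (hp' : ∀ i < m, ∀ j ≤ m, i + 1 < j → p (s i) (x j) = x j)
    {k : ℕ} (hk : k ≤ m) {g : G} (hg : g ∈ initialSubgroup s k) (h1 : p g = 1) : g = 1 := by
  have hfix : ∀ k j, k < j → j ≤ m → ∀ d ∈ initialSubgroup s k, p d (x j) = x j := by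
    intro k j hkj hj d hd
    induction hd using Subgroup.closure_induction with
    | mem y hy =>
      obtain ⟨i, hi, rfl⟩ := hy
      exact hp' i (by omega) j hj (by omega)
    | one => simp
    | mul y z _ _ hy hz => rw [map_mul, Equiv.Perm.mul_apply, hz, hy]
    | inv y _ hy => rw [map_inv, Equiv.Perm.inv_eq_iff_eq, hy]
  have hchain : ∀ j e, j + e ≤ m → p (chain s j e) (x j) = x (j + e) := by
    intro j e
    induction e with
    | zero => simp [chain]
    | succ e ih =>
      intro he
      rw [chain, map_mul, Equiv.Perm.mul_apply, ih (by omega), hp _ (by omega), add_assoc]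
  induction k generalizing g with
  | zero =>
    have : initialSubgroup s 0 = ⊥ := by simp [initialSubgroup]
    rwa [this, Subgroup.mem_bot] at hg
  | succ k ih =>
    obtain ⟨d, hd, j, e, hje, rfl⟩ := h.exists_chain hs (by omega) hg
    -- The chain carries `x j` to `x (k + 1)` and `d` fixes `x (k + 1)`; triviality of the
    -- permutation thus makes the chain empty.
    have hj : x (k + 1) = x j := by
      have := congrArg (fun q => q (x j)) h1
      simp only [map_mul, Equiv.Perm.mul_apply, Equiv.Perm.one_apply] at this
      rwa [hchain j e (by omega), hje, hfix k (k + 1) (by omega) hk d hd] at this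
    obtain rfl := hx _ hk _ (by omega) hj
    obtain rfl : e = 0 := by omega
    simp only [chain, mul_one] at h1 ⊢
    exact ih (by omega) hd h1

/-! ### The elements `A_{i,j}` in a group with Artin generators -/

/-- The element `s_{j-1} ⋯ s_{i+1} s_i² s_{i+1}⁻¹ ⋯ s_{j-1}⁻¹`, for `i < j`. -/
def artinA (s : ℕ → G) (i : ℕ) : ℕ → G
  | 0 => s i ^ 2
  | j + 1 => if j ≤ i then s i ^ 2 else s j * artinA s i j * (s j)⁻¹

theorem artinA_self (s : ℕ → G) (i : ℕ) : artinA s i (i + 1) = s i ^ 2 := by simp [artinA]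

theorem artinA_succ (s : ℕ → G) {i j : ℕ} (h : i < j) :
    artinA s i (j + 1) = s j * artinA s i j * (s j)⁻¹ := by
  simp [artinA, not_le.mpr h]

theorem IsArtin.commute_artinA_outer (h : IsArtin s m) {k i j : ℕ} (hij : i < j) (hj : j ≤ m)
    (hk : k < m) (hout : k + 1 < i ∨ j < k) : Commute (s k) (artinA s i j) := by
  induction j, hij using Nat.le_induction with
  | base =>
    rw [artinA_self]
    exact (h.commute (by omega) hk (by omega)).pow_right 2
  | succ j hij ih =>
    rw [artinA_succ s (by omega)]
    have hc : Commute (s k) (s j) := h.commute (by omega) hk (by omega)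
    exact (hc.mul_right (ih (by omega) (by omega))).mul_right hc.inv_right

/-- For `j = k + 2`, conjugation by `s (k + 1) * s k` turns the commuting pair `s (k + 1)`,
`A_{i,k}` into `s k`, `A_{i,k+2}`. Later conjugating letters commute with `s k`. -/
theorem IsArtin.commute_artinA_inner (h : IsArtin s m) {k i j : ℕ} (hik : i < k)
    (hkj : k + 1 < j) (hj : j ≤ m) : Commute (s k) (artinA s i j) := by
  induction j, hkj using Nat.le_induction with
  | base =>
    have hc : Commute (s (k + 1)) (artinA s i k) :=
      h.commute_artinA_outer hik (by omega) (by omega) (by omega)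
    have hb := h.braid k (by omega)
    rw [show (k + 1).succ = (k + 1) + 1 from rfl, artinA_succ s (by omega), artinA_succ s hik]
    have e : s (k + 1) * (s k * artinA s i k * (s k)⁻¹) * (s (k + 1))⁻¹ =
        (s (k + 1) * s k) * artinA s i k * (s (k + 1) * s k)⁻¹ := by group
    have hb' : s k = (s (k + 1) * s k) * s (k + 1) * (s (k + 1) * s k)⁻¹ := by
      rw [hb]; group
    rw [e]
    nth_rewrite 1 [hb']
    exact (Commute.conj_iff _).2 hc
  | succ j hkj ih =>
    rw [artinA_succ s (by omega)]
    have hc : Commute (s k) (s j) := h.commute (by omega) (by omega) (by omega)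
    exact (hc.mul_right (ih (by omega))).mul_right hc.inv_right

/-- In the base case, conjugation by `s i * s (i + 1)` takes `s i` to `s (i + 1)`; the later letters
commute with `s i`. -/
theorem IsArtin.conj_artinA_bot (h : IsArtin s m) {i j : ℕ} (hij : i + 1 < j) (hj : j ≤ m) :
    s i * artinA s i j * (s i)⁻¹ = artinA s (i + 1) j := by
  induction j, hij using Nat.le_induction with
  | base =>
    have hb := h.braid i (by omega)
    rw [artinA_self, artinA_succ s (by omega), artinA_self]
    have hb' : s (i + 1) = (s i * s (i + 1)) * s i * (s i * s (i + 1))⁻¹ := by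
      rw [← hb]; group
    have : s (i + 1) ^ 2 = (s i * s (i + 1)) * s i ^ 2 * (s i * s (i + 1))⁻¹ := by
      rw [← conj_pow, ← hb']
    rw [this]; group
  | succ j hij ih =>
    have hc : s i * s j = s j * s i := h.comm i j (by omega) (by omega)
    rw [artinA_succ s (by omega), artinA_succ s (by omega), ← ih (by omega)]
    have e : s i * (s j * artinA s i j * (s j)⁻¹) * (s i)⁻¹ =
        (s i * s j) * artinA s i j * (s i * s j)⁻¹ := by group
    rw [e, hc]; group

theorem IsArtin.conj_artinA_top_inv {i k : ℕ} (hik : i < k) :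
    s k * artinA s i (k + 1) * (s k)⁻¹ =
      artinA s k (k + 1) * artinA s i k * (artinA s k (k + 1))⁻¹ := by
  rw [artinA_succ s hik, artinA_self, sq]; group

theorem IsArtin.conj_artinA_bot_inv (h : IsArtin s m) {k j : ℕ} (hkj : k + 1 < j) (hj : j ≤ m) :
    s k * artinA s (k + 1) j * (s k)⁻¹ =
      artinA s k (k + 1) * artinA s k j * (artinA s k (k + 1))⁻¹ := by
  rw [← h.conj_artinA_bot hkj hj, artinA_self, sq]; group

/-- The product equals `s (i + 1) * s i * s i * s (i + 1)`, the last strand circling the two others,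
and two uses of the braid relation move `s i` across it. This is the source of all relations on
three strands. -/
theorem IsArtin.commute_artinA_triangle (h : IsArtin s m) {i : ℕ} (hi : i + 1 < m) :
    Commute (artinA s i (i + 1)) (artinA s i (i + 2) * artinA s (i + 1) (i + 2)) := by
  have e : artinA s i (i + 2) * artinA s (i + 1) (i + 2) = s (i + 1) * s i * (s i * s (i + 1)) := by
    rw [artinA_succ s (by omega), artinA_self, artinA_self, sq, sq]; group
  have hb := h.braid i hi
  have hc : Commute (s i) (s (i + 1) * s i * (s i * s (i + 1))) := by
    change s i * (s (i + 1) * s i * (s i * s (i + 1))) = s (i + 1) * s i * (s i * s (i + 1)) * s i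
    calc _ = (s i * s (i + 1) * s i) * (s i * s (i + 1)) := by group
      _ = (s (i + 1) * s i) * (s (i + 1) * s i * s (i + 1)) := by rw [← hb]; group
      _ = _ := by rw [hb]; group
  rw [e, artinA_self]
  exact hc.pow_left 2

/-- The transposition `(k, k + 1)` on natural numbers. -/
def natSwap (k i : ℕ) : ℕ := if i = k then k + 1 else if i = k + 1 then k else i

/-- The element `A_{i,j}` with the convention `A_{j,i} = A_{i,j}`. -/
def symA (s : ℕ → G) (i j : ℕ) : G := artinA s (min i j) (max i j)

theorem symA_comm (s : ℕ → G) (i j : ℕ) : symA s i j = symA s j i := by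
  rw [symA, symA, min_comm, max_comm]

theorem symA_of_lt (s : ℕ → G) {i j : ℕ} (h : i < j) : symA s i j = artinA s i j := by
  rw [symA, min_eq_left h.le, max_eq_right h.le]

theorem IsArtin.conj_artinA_other (h : IsArtin s m) {k i j : ℕ} (hij : i < j) (hj : j ≤ m)
    (hk : k < m) (h1 : ¬ (j = k + 1 ∧ i < k)) (h2 : i ≠ k + 1) :
    s k * artinA s i j * (s k)⁻¹ = symA s (natSwap k i) (natSwap k j) := by
  have hcomm (hc : Commute (s k) (artinA s i j)) :
      s k * artinA s i j * (s k)⁻¹ = artinA s i j := by rw [hc.eq, mul_inv_cancel_right]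
  by_cases hik : i = k
  · subst hik
    rcases (Nat.succ_le_of_lt hij).eq_or_lt with hj1 | hj1
    · obtain rfl : j = i + 1 := hj1.symm
      rw [hcomm (by rw [artinA_self]; exact (Commute.refl _).pow_right 2)]
      simp [natSwap, symA]
    · rw [h.conj_artinA_bot hj1 hj]
      have e : natSwap i j = j := by unfold natSwap; split_ifs <;> omega
      have e' : natSwap i i = i + 1 := by simp [natSwap]
      rw [e, e', symA_of_lt s hj1]
  · have e : natSwap k i = i := by unfold natSwap; split_ifs; omega
    by_cases hjk : j = k
    · subst hjk
      have e' : natSwap j j = j + 1 := by simp [natSwap]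
      rw [e, e', symA_of_lt s (by omega), artinA_succ s hij]
    · have e' : natSwap k j = j := by unfold natSwap; split_ifs <;> omega
      rw [e, e', symA_of_lt s hij, hcomm]
      by_cases hin : i < k ∧ k + 1 < j
      · exact h.commute_artinA_inner hin.1 hin.2 hj
      · exact h.commute_artinA_outer hij hj hk (by omega)

/-- The correcting factor `c` is pure, so modulo `Γ₂` only the permutation of the indices survives.
-/
theorem IsArtin.conj_artinA (h : IsArtin s m) {k i j : ℕ} (hij : i < j) (hj : j ≤ m)
    (hk : k < m) : ∃ c, (c = 1 ∨ c = s k ^ 2) ∧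
      s k * artinA s i j * (s k)⁻¹ = c * symA s (natSwap k i) (natSwap k j) * c⁻¹ := by
  by_cases h1 : j = k + 1 ∧ i < k
  · obtain ⟨rfl, hik⟩ := h1
    refine ⟨_, Or.inr rfl, ?_⟩
    have e : natSwap k i = i := by unfold natSwap; split_ifs <;> omega
    have e' : natSwap k (k + 1) = k := by simp [natSwap]
    rw [conj_artinA_top_inv hik, e, e', symA_of_lt s hik, artinA_self]
  by_cases h2 : i = k + 1
  · subst h2
    refine ⟨_, Or.inr rfl, ?_⟩
    have e : natSwap k j = j := by unfold natSwap; split_ifs <;> omega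
    have e' : natSwap k (k + 1) = k := by simp [natSwap]
    rw [h.conj_artinA_bot_inv hij hj, e, e', symA_of_lt s (by omega), artinA_self]
  · exact ⟨1, Or.inl rfl, by rw [h.conj_artinA_other hij hj hk h1 h2, one_mul, inv_one, mul_one]⟩

end Artin

/-! ### Groups of nilpotency class two -/

section ClassTwo

variable {G : Type*} [Group G] {P : Subgroup G}

/-- The subgroup `P` is nilpotent of class at most two. -/
def ClassTwo (P : Subgroup G) : Prop := ∀ x ∈ P, ∀ y ∈ P, ∀ z ∈ P, Commute ⁅x, y⁆ z

theorem ClassTwo.commute (h : ClassTwo P) {z x : G} (hz : z ∈ ⁅P, P⁆) (hx : x ∈ P) :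
    Commute z x := by
  have : ⁅P, P⁆ ≤ Subgroup.centralizer P := by
    rw [Subgroup.commutator_le]
    exact fun a ha b hb => Subgroup.mem_centralizer_iff.2 fun c hc => (h a ha b hb c hc).symm
  exact (Subgroup.mem_centralizer_iff.1 (this hz) x hx).symm

theorem classTwo_iff_lowerCentralSeries : ClassTwo P ↔ P.lowerCentralSeries 2 = ⊥ := by
  change _ ↔ ⁅⁅P, P⁆, P⁆ = ⊥
  rw [Subgroup.commutator_eq_bot_iff_le_centralizer]
  constructor
  · exact fun h z hz => Subgroup.mem_centralizer_iff.2 fun x hx => (h.commute hz hx).symm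
  · exact fun h x hx y hy z hz => (Subgroup.mem_centralizer_iff.1
      (h (Subgroup.commutator_mem_commutator hx hy)) z hz).symm

theorem ClassTwo.commutator_mul_left (h : ClassTwo P) {x y z : G} (hx : x ∈ P) (hy : y ∈ P)
    (hz : z ∈ P) : ⁅x * y, z⁆ = ⁅x, z⁆ * ⁅y, z⁆ := by
  rw [commutatorElement_mul_left_eq_conj_mul, ← (h y hy z hz x hx).eq, mul_inv_cancel_right,
    (h y hy z hz ⁅x, z⁆ (Subgroup.commutator_le_self P
      (Subgroup.commutator_mem_commutator hx hz))).eq]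

theorem ClassTwo.commutator_mul_right (h : ClassTwo P) {x y z : G} (hx : x ∈ P) (hy : y ∈ P)
    (hz : z ∈ P) : ⁅x, y * z⁆ = ⁅x, y⁆ * ⁅x, z⁆ := by
  rw [commutatorElement_mul_right_eq_mul_conj, mul_assoc, mul_assoc, ← mul_assoc y,
    ← (h x hx z hz y hy).eq, mul_inv_cancel_right]

/-- Central factors do not affect commutators. This turns information modulo `Γ₂` into exact
identities between commutators. -/
theorem ClassTwo.commutator_central_mul (h : ClassTwo P) {x y z w : G} (hx : x ∈ P) (hy : y ∈ P)
    (hz : z ∈ ⁅P, P⁆) (hw : w ∈ ⁅P, P⁆) : ⁅z * x, w * y⁆ = ⁅x, y⁆ := by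
  have hle := Subgroup.commutator_le_self P
  rw [h.commutator_mul_left (hle hz) hx (mul_mem (hle hw) hy),
    (h.commute hz (mul_mem (hle hw) hy)).commutator_eq, one_mul,
    h.commutator_mul_right hx (hle hw) hy, (h.commute hw hx).symm.commutator_eq, one_mul]

end ClassTwo

/-! ### The group `B_n / Γ₃(P_n)` -/

/-- The Artin generators of the braid group, numbered by natural numbers. -/
def natSigma (n k : ℕ) : BraidGroup n := if h : k < n - 1 then sigma ⟨k, h⟩ else 1

theorem natSigma_val {n : ℕ} (k : Fin (n - 1)) : natSigma n k.val = sigma k := by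
  simp [natSigma]

theorem artinRel_eq {n : ℕ} {u v : FreeGroup (Fin (n - 1))} (h : ArtinRel n u v) :
    FreeGroup.lift (sigma (n := n)) u = FreeGroup.lift sigma v := by
  have e : FreeGroup.lift (sigma (n := n)) = PresentedGroup.mk (relators (ArtinRel n)) := by
    ext k; simp [sigma, PresentedGroup.of]
  rw [e]
  exact PresentedGroup.mk_eq_mk_of_mul_inv_mem ⟨u, v, h, rfl⟩

theorem isArtin_natSigma (n : ℕ) : IsArtin (natSigma n) (n - 1) := by
  constructor
  · intro i j hij hj
    have := artinRel_eq (ArtinRel.comm ⟨i, by omega⟩ (⟨j, hj⟩ : Fin (n - 1)) hij)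
    simpa [natSigma, hj, show i < n - 1 by omega] using this
  · intro i hi
    have := artinRel_eq (ArtinRel.braid ⟨i, by omega⟩ (⟨i + 1, hi⟩ : Fin (n - 1)) rfl)
    simpa [natSigma, hi, show i < n - 1 by omega] using this

theorem braidAux_eq {n : ℕ} (i : ℕ) : ∀ (j : ℕ) (h : i < j) (hn : j < n),
    braidAux i j h hn = artinA (natSigma n) i j
  | 0, h, _ => absurd h (Nat.not_lt_zero i)
  | j + 1, h, hn => by
    have e : natSigma n j = sigma ⟨j, by omega⟩ := natSigma_val ⟨j, by omega⟩
    unfold braidAux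
    split_ifs with hij
    · subst hij; rw [artinA_self, e]
    · rw [artinA_succ _ (by omega), braidAux_eq i j (by omega) (by omega), e]

theorem adjSwap_val {n : ℕ} (k : Fin (n - 1)) (i : Fin n) :
    (adjSwap k i).val = natSwap k.val i.val := by
  unfold adjSwap natSwap
  rw [Equiv.swap_apply_def]
  simp only [Fin.ext_iff, lo, hi]
  split_ifs <;> rfl

theorem permHom_sigma {n : ℕ} (k : Fin (n - 1)) : permHom n (sigma k) = adjSwap k := by
  simp [permHom, sigma]

theorem braid_induction {n : ℕ} {C : BraidGroup n → Prop} (one : C 1)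
    (mul : ∀ x y, C x → C y → C (x * y)) (inv : ∀ x, C x → C x⁻¹) (gen : ∀ k, C (sigma k))
    (x : BraidGroup n) : C x :=
  PresentedGroup.generated_by _
    { carrier := {x | C x}, one_mem' := one, mul_mem' := mul _ _, inv_mem' := inv _ } gen x

theorem permHom_surjective (n : ℕ) : Function.Surjective (permHom n) := by
  rcases n with _ | n
  · exact fun p => ⟨1, Subsingleton.elim _ _⟩
  rw [← MonoidHom.range_eq_top, eq_top_iff]
  intro p _
  have hp : p ∈ Submonoid.closure (Set.range fun i : Fin n => Equiv.swap i.castSucc i.succ) := by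
    rw [Equiv.Perm.mclosure_swap_castSucc_succ]; trivial
  refine (Submonoid.closure_le (S := (permHom (n + 1)).range.toSubmonoid)).2 ?_ hp
  rintro _ ⟨i, rfl⟩
  exact ⟨sigma (n := n + 1) i, permHom_sigma (n := n + 1) i⟩

/-- The pure braid group is the normal closure of the squares of the Artin generators. -/
theorem pureBraid_le {n : ℕ} (hn : 0 < n) (N : Subgroup (BraidGroup n)) [N.Normal]
    (h : ∀ k, sigma k ^ 2 ∈ N) : pureBraid n ≤ N := by
  intro g hg
  -- In this product the Artin generators become involutions, and the second factor provides the
  -- permutation action required by `eq_one_of_perm`. So the permutation of an element of the image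
  -- determines its class modulo `N`.
  let f : BraidGroup n →* (BraidGroup n ⧸ N) × Equiv.Perm (Fin n) :=
    (QuotientGroup.mk' N).prod (permHom n)
  have hA := (isArtin_natSigma n).map f
  have hgen : ∀ x, f x ∈ initialSubgroup (fun i => f (natSigma n i)) (n - 1) := by
    intro x
    induction x using braid_induction with
    | one => rw [map_one]; exact one_mem _
    | mul x y hx hy => rw [map_mul]; exact mul_mem hx hy
    | inv x hx => rw [map_inv]; exact inv_mem hx
    | gen k => rw [← natSigma_val]; exact mem_initialSubgroup (s := fun i => f (natSigma n i)) k.isLt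
  have hval : ∀ i (hi : i < n - 1), natSigma n i = sigma ⟨i, hi⟩ :=
    fun i hi => natSigma_val ⟨i, hi⟩
  have hsnd : ∀ i (hi : i < n - 1), (f (natSigma n i)).2 = adjSwap ⟨i, hi⟩ := by
    intro i hi; rw [hval i hi]; exact permHom_sigma _
  -- The truncation `min i (n - 1)` only makes the list of points total; it is the identity on the
  -- indices `i ≤ n - 1` in use.
  have hone : f g = 1 := by
    refine hA.eq_one_of_perm ?_ (MonoidHom.snd _ _)
      (fun i => (⟨min i (n - 1), by omega⟩ : Fin n)) ?_ ?_ ?_ le_rfl (hgen g) hg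
    · intro i hi
      rw [hval i hi, ← map_mul, ← sq]
      refine Prod.ext ((QuotientGroup.eq_one_iff _).2 (h _)) ?_
      change permHom n _ = 1
      rw [map_pow, permHom_sigma, sq]
      exact Equiv.swap_mul_self _ _
    · intro i hi j hj hij
      simp only [Fin.mk.injEq] at hij
      omega
    · intro i hi
      refine Fin.ext ?_
      change ((f (natSigma n i)).2 _).val = _
      rw [hsnd i hi, adjSwap_val]
      simp only [natSwap]
      split_ifs <;> omega
    · intro i hi j hj hij
      refine Fin.ext ?_
      change ((f (natSigma n i)).2 _).val = _
      rw [hsnd i hi, adjSwap_val]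
      simp only [natSwap]
      split_ifs <;> omega
  exact (QuotientGroup.eq_one_iff _).1 (congrArg Prod.fst hone)

/-- The image of the pure braid group in `B_n / Γ₃(P_n)`. -/
def barP (n : ℕ) : Subgroup (BraidQuotient n) := (pureBraid n).map (QuotientGroup.mk' (gammaThree n))

instance (n : ℕ) : (barP n).Normal :=
  Subgroup.Normal.map inferInstance _ (QuotientGroup.mk'_surjective _)

theorem classTwo_barP (n : ℕ) : ClassTwo (barP n) := by
  rw [classTwo_iff_lowerCentralSeries, barP, ← Subgroup.map_lowerCentralSeries]
  exact (Subgroup.map_eq_bot_iff _).2 (by rw [QuotientGroup.ker_mk']; rfl)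

/-- The class of `A_{i,j}` in `B_n / Γ₃(P_n)`, with the convention `A_{j,i} = A_{i,j}`. -/
def barA {n : ℕ} (i j : Fin n) : BraidQuotient n :=
  QuotientGroup.mk (symA (natSigma n) i.val j.val)

/-- The class of an Artin generator in `B_n / Γ₃(P_n)`. -/
def barSigma {n : ℕ} (k : Fin (n - 1)) : BraidQuotient n := QuotientGroup.mk (sigma k)

theorem barA_comm {n : ℕ} (i j : Fin n) : barA i j = barA j i := by
  rw [barA, symA_comm]; rfl

theorem mk_pureA {n : ℕ} (i j : Fin n) (h : i < j) :
    (QuotientGroup.mk (pureA i j h : BraidGroup n) : BraidQuotient n) = barA i j := by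
  rw [barA, symA_of_lt _ h]
  exact congrArg QuotientGroup.mk (braidAux_eq _ _ _ _)

theorem barA_mem {n : ℕ} {i j : Fin n} (h : i ≠ j) : barA i j ∈ barP n := by
  rcases h.lt_or_gt with h | h
  · exact ⟨_, (pureA i j h).2, mk_pureA i j h⟩
  · rw [barA_comm]
    exact ⟨_, (pureA j i h).2, mk_pureA j i h⟩

theorem sigma_sq_mem {n : ℕ} (k : Fin (n - 1)) : sigma k ^ 2 ∈ pureBraid n := by
  rw [pureBraid, MonoidHom.mem_ker, map_pow, permHom_sigma, sq]
  exact Equiv.swap_mul_self _ _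

theorem conj_barSigma {n : ℕ} (k : Fin (n - 1)) {i j : Fin n} (h : i ≠ j) :
    ∃ z ∈ ⁅barP n, barP n⁆, barSigma k * barA i j * (barSigma k)⁻¹ =
      z * barA (adjSwap k i) (adjSwap k j) := by
  wlog hij : i < j generalizing i j
  · rw [barA_comm, barA_comm (adjSwap k i)]
    exact this h.symm (h.lt_or_gt.resolve_left hij)
  obtain ⟨c, hc, he⟩ := (isArtin_natSigma n).conj_artinA hij (by omega) k.isLt
  have hcP : c ∈ pureBraid n := by
    rcases hc with rfl | rfl
    · exact one_mem _
    · rw [natSigma_val]; exact sigma_sq_mem k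
  refine ⟨⁅QuotientGroup.mk c, barA (adjSwap k i) (adjSwap k j)⁆,
    Subgroup.commutator_mem_commutator ⟨c, hcP, rfl⟩
      (barA_mem ((adjSwap k).injective.ne h)), ?_⟩
  rw [← symA_of_lt _ hij, natSigma_val, ← adjSwap_val, ← adjSwap_val] at he
  have := congrArg (QuotientGroup.mk (s := gammaThree n)) he
  simp only [QuotientGroup.mk_mul, QuotientGroup.mk_inv] at this
  rw [commutatorElement_def, inv_mul_cancel_right]
  exact this

/-- Modulo `Γ₂`, braids permute the classes of the `A_{i,j}`. -/
theorem conj_barA {n : ℕ} (g : BraidGroup n) {i j : Fin n} (h : i ≠ j) :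
    ∃ z ∈ ⁅barP n, barP n⁆, (g : BraidQuotient n) * barA i j * (g : BraidQuotient n)⁻¹ =
      z * barA (permHom n g i) (permHom n g j) := by
  have hN : (⁅barP n, barP n⁆).Normal := inferInstance
  induction g using braid_induction generalizing i j with
  | one => exact ⟨1, one_mem _, by simp⟩
  | mul x y hx hy =>
    obtain ⟨z, hz, hyz⟩ := hy h
    obtain ⟨w, hw, hxw⟩ := hx ((permHom n y).injective.ne h)
    refine ⟨x * z * (x : BraidQuotient n)⁻¹ * w, mul_mem (hN.conj_mem _ hz _) hw, ?_⟩
    rw [map_mul, Equiv.Perm.mul_apply, Equiv.Perm.mul_apply, mul_assoc (_ * _ * _), ← hxw,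
      QuotientGroup.mk_mul]
    have e : (x : BraidQuotient n) * y * barA i j * ((x : BraidQuotient n) * y)⁻¹ =
      x * ((y : BraidQuotient n) * barA i j * (y : BraidQuotient n)⁻¹) *
        (x : BraidQuotient n)⁻¹ := by group
    rw [e, hyz]; group
  | inv x hx =>
    obtain ⟨z, hz, hxz⟩ := hx ((permHom n x)⁻¹.injective.ne h)
    refine ⟨(x : BraidQuotient n)⁻¹ * z⁻¹ * (x : BraidQuotient n)⁻¹⁻¹,
      hN.conj_mem _ (inv_mem hz) _, ?_⟩
    rw [← Equiv.Perm.mul_apply, ← Equiv.Perm.mul_apply, mul_inv_cancel, Equiv.Perm.one_apply,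
      Equiv.Perm.one_apply] at hxz
    have e : barA i j = z⁻¹ * (x * barA ((permHom n x)⁻¹ i) ((permHom n x)⁻¹ j) *
      (x : BraidQuotient n)⁻¹) := by rw [hxz, inv_mul_cancel_left]
    rw [map_inv, QuotientGroup.mk_inv]
    nth_rewrite 1 [e]
    group
  | gen k => rw [permHom_sigma]; exact conj_barSigma k h

/-- The errors in `conj_barA` lie in `Γ₂` and drop out of the commutator, so this identity is exact.
-/
theorem conj_commutator_barA {n : ℕ} (g : BraidGroup n) {i j k l : Fin n} (hij : i ≠ j)
    (hkl : k ≠ l) : (g : BraidQuotient n) * ⁅barA i j, barA k l⁆ * (g : BraidQuotient n)⁻¹ =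
      ⁅barA (permHom n g i) (permHom n g j), barA (permHom n g k) (permHom n g l)⁆ := by
  obtain ⟨z, hz, hz'⟩ := conj_barA g hij
  obtain ⟨w, hw, hw'⟩ := conj_barA g hkl
  rw [conjugate_commutatorElement, hz', hw', (classTwo_barP n).commutator_central_mul
    (barA_mem ((permHom n g).injective.ne hij)) (barA_mem ((permHom n g).injective.ne hkl)) hz hw]

/-- Permutations act transitively on tuples of distinct strands and lift to braids, so a commutator
relation spreads from one configuration to all. -/
theorem exists_braid_map {n d : ℕ} (x y : Fin d ↪ Fin n) :
    ∃ g : BraidGroup n, ∀ a, permHom n g (x a) = y a := by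
  obtain ⟨p, hp⟩ := (Equiv.Perm.isMultiplyPretransitive (Fin n) d).exists_smul_eq x y
  obtain ⟨g, rfl⟩ := permHom_surjective n p
  exact ⟨g, fun a => DFunLike.congr_fun hp a⟩

theorem commutator_barA_disjoint {n : ℕ} {i j k l : Fin n} (hij : i ≠ j) (hik : i ≠ k)
    (hil : i ≠ l) (hjk : j ≠ k) (hjl : j ≠ l) (hkl : k ≠ l) : ⁅barA i j, barA k l⁆ = 1 := by
  have hn : 4 ≤ n := by
    have := Finset.card_le_univ {i, j, k, l}
    rwa [Fintype.card_fin, Finset.card_insert_of_notMem (by simp [*]),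
      Finset.card_insert_of_notMem (by simp [*]), Finset.card_pair hkl] at this
  obtain ⟨g, hg⟩ := exists_braid_map (Fin.castLEEmb hn)
    ⟨![i, j, k, l], by
      intro a b h
      fin_cases a <;> fin_cases b <;> simp_all [eq_comm]⟩
  have h0 : permHom n g (Fin.castLEEmb hn 0) = i := hg 0
  have h1 : permHom n g (Fin.castLEEmb hn 1) = j := hg 1
  have h2 : permHom n g (Fin.castLEEmb hn 2) = k := hg 2
  have h3 : permHom n g (Fin.castLEEmb hn 3) = l := hg 3
  -- On the first four strands the two elements are squares of distant Artin generators.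
  have hc : Commute (barA (Fin.castLEEmb hn 0) (Fin.castLEEmb hn 1))
      (barA (Fin.castLEEmb hn 2) (Fin.castLEEmb hn 3)) := by
    have : Commute (natSigma n 0) (natSigma n 2) := (isArtin_natSigma n).comm 0 2 le_rfl (by omega)
    have := (this.pow_pow 2 2).map (QuotientGroup.mk' (gammaThree n))
    rwa [← artinA_self, ← artinA_self, ← symA_of_lt _ (by omega), ← symA_of_lt _ (by omega)] at this
  have := conj_commutator_barA g (i := Fin.castLEEmb hn 0) (j := Fin.castLEEmb hn 1)
    (k := Fin.castLEEmb hn 2) (l := Fin.castLEEmb hn 3) (by simp) (by simp)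
  rw [hc.commutator_eq, h0, h1, h2, h3] at this
  rwa [mul_one, mul_inv_cancel, eq_comm] at this

theorem commutator_barA_triangle {n : ℕ} {i j k : Fin n} (hij : i ≠ j) (hik : i ≠ k)
    (hjk : j ≠ k) : ⁅barA i j, barA i k⁆ = ⁅barA i j, barA j k⁆⁻¹ := by
  have hn : 3 ≤ n := by
    have := Finset.card_le_univ {i, j, k}
    rwa [Fintype.card_fin, Finset.card_insert_of_notMem (by simp [*]), Finset.card_pair hjk] at this
  obtain ⟨g, hg⟩ := exists_braid_map (Fin.castLEEmb hn)
    ⟨![i, j, k], by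
      intro a b h
      fin_cases a <;> fin_cases b <;> simp_all [eq_comm]⟩
  have h0 : permHom n g (Fin.castLEEmb hn 0) = i := hg 0
  have h1 : permHom n g (Fin.castLEEmb hn 1) = j := hg 1
  have h2 : permHom n g (Fin.castLEEmb hn 2) = k := hg 2
  set a := Fin.castLEEmb hn 0
  set b := Fin.castLEEmb hn 1
  set c := Fin.castLEEmb hn 2
  have hab : a ≠ b := by simp [a, b]
  have hac : a ≠ c := by simp [a, c]
  have hbc : b ≠ c := by simp [b, c]
  -- On the first three strands this is `commute_artinA_triangle`; bilinearity of the commutator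
  -- splits it into the required identity.
  have hc : Commute (barA a b) (barA a c * barA b c) := by
    have := ((isArtin_natSigma n).commute_artinA_triangle (i := 0) (by omega)).map
      (QuotientGroup.mk' (gammaThree n))
    rwa [map_mul, ← symA_of_lt _ (by omega), ← symA_of_lt _ (by omega),
      ← symA_of_lt _ (by omega)] at this
  have h := hc.commutator_eq
  rw [(classTwo_barP n).commutator_mul_right (barA_mem hab) (barA_mem hac) (barA_mem hbc)] at h
  have h' := congrArg (fun x => (g : BraidQuotient n) * x * (g : BraidQuotient n)⁻¹) h
  simp only [← conj_mul] at h'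
  rw [conj_commutator_barA g hab hac, conj_commutator_barA g hab hbc, h0, h1, h2] at h'
  exact eq_inv_of_mul_eq_one_left (by rwa [mul_one, mul_inv_cancel] at h')

/-- The class of `[A_{r,s}, A_{s,t}]` in `B_n / Γ₃(P_n)`. -/
def barAlpha {n : ℕ} (r s t : Fin n) : BraidQuotient n := ⁅barA r s, barA s t⁆

theorem mk_pureAlpha {n : ℕ} (r s t : Fin n) (hrs : r < s) (hst : s < t) :
    (QuotientGroup.mk (pureAlpha r s t hrs hst : BraidGroup n) : BraidQuotient n) =
      barAlpha r s t := by
  rw [barAlpha, ← mk_pureA r s hrs, ← mk_pureA s t hst]; rfl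

theorem barAlpha_reverse {n : ℕ} (r s t : Fin n) : barAlpha t s r = (barAlpha r s t)⁻¹ := by
  rw [barAlpha, barAlpha, commutatorElement_inv, barA_comm t, barA_comm s r]

/-- Together with `barAlpha_reverse` this makes `barAlpha` alternating in its indices, so the signs
in (iii) follow from `conj_barAlpha`. -/
theorem barAlpha_swap_left {n : ℕ} {r s t : Fin n} (hrs : r ≠ s) (hrt : r ≠ t) (hst : s ≠ t) :
    barAlpha s r t = (barAlpha r s t)⁻¹ := by
  rw [barAlpha, barAlpha, barA_comm s, commutator_barA_triangle hrs hrt hst]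

theorem barAlpha_swap_right {n : ℕ} {r s t : Fin n} (hrs : r ≠ s) (hrt : r ≠ t) (hst : s ≠ t) :
    barAlpha r t s = (barAlpha r s t)⁻¹ := by
  rw [barAlpha_reverse s t r, barAlpha_swap_left hst.symm hrt.symm hrs.symm, inv_inv,
    barAlpha_reverse r s t]

theorem barAlpha_mem {n : ℕ} {r s t : Fin n} (hrs : r ≠ s) (hst : s ≠ t) :
    barAlpha r s t ∈ ⁅barP n, barP n⁆ :=
  Subgroup.commutator_mem_commutator (barA_mem hrs) (barA_mem hst)

theorem conj_barAlpha {n : ℕ} (k : Fin (n - 1)) {r s t : Fin n} (hrs : r ≠ s) (hst : s ≠ t) :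
    barSigma k * barAlpha r s t * (barSigma k)⁻¹ =
      barAlpha (adjSwap k r) (adjSwap k s) (adjSwap k t) := by
  have := conj_commutator_barA (sigma k) hrs hst
  rwa [permHom_sigma] at this

/-! ### A linear model of `B_n / Γ₃(P_n)` -/

section Model

variable {n : ℕ}

/-- The alternating pairing of functions on pairs with values in functions on triples. -/
def bracket (v v' : Fin n → Fin n → ℚ) : Fin n → Fin n → Fin n → ℚ := fun a b c =>
  (v a b * v' b c - v b c * v' a b) + (v b c * v' c a - v c a * v' b c) +
    (v c a * v' a b - v a b * v' c a)

/-- Permutations act on functions on pairs. -/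
def permPair (p : Equiv.Perm (Fin n)) (v : Fin n → Fin n → ℚ) : Fin n → Fin n → ℚ :=
  fun a b => v (p⁻¹ a) (p⁻¹ b)

/-- Permutations act on functions on triples. -/
def permTriple (p : Equiv.Perm (Fin n)) (w : Fin n → Fin n → Fin n → ℚ) :
    Fin n → Fin n → Fin n → ℚ :=
  fun a b c => w (p⁻¹ a) (p⁻¹ b) (p⁻¹ c)

theorem bracket_add_left (u v w : Fin n → Fin n → ℚ) :
    bracket (u + v) w = bracket u w + bracket v w := by
  funext a b c; simp only [bracket, Pi.add_apply]; ring

theorem bracket_add_right (u v w : Fin n → Fin n → ℚ) :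
    bracket u (v + w) = bracket u v + bracket u w := by
  funext a b c; simp only [bracket, Pi.add_apply]; ring

theorem bracket_swap (u v : Fin n → Fin n → ℚ) : bracket v u = -bracket u v := by
  funext a b c; simp only [bracket, Pi.neg_apply]; ring

theorem bracket_smul_left (r : ℚ) (u v : Fin n → Fin n → ℚ) :
    bracket (r • u) v = r • bracket u v := by
  funext a b c; simp only [bracket, Pi.smul_apply, smul_eq_mul]; ring

theorem bracket_smul_right (r : ℚ) (u v : Fin n → Fin n → ℚ) :
    bracket u (r • v) = r • bracket u v := by
  funext a b c; simp only [bracket, Pi.smul_apply, smul_eq_mul]; ring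

theorem permPair_add (p : Equiv.Perm (Fin n)) (v w : Fin n → Fin n → ℚ) :
    permPair p (v + w) = permPair p v + permPair p w := rfl

theorem permTriple_add (p : Equiv.Perm (Fin n)) (v w : Fin n → Fin n → Fin n → ℚ) :
    permTriple p (v + w) = permTriple p v + permTriple p w := rfl

theorem permPair_neg (p : Equiv.Perm (Fin n)) (v : Fin n → Fin n → ℚ) :
    permPair p (-v) = -permPair p v := rfl

theorem permPair_smul (p : Equiv.Perm (Fin n)) (r : ℚ) (v : Fin n → Fin n → ℚ) :
    permPair p (r • v) = r • permPair p v := rfl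

theorem permTriple_smul (p : Equiv.Perm (Fin n)) (r : ℚ) (v : Fin n → Fin n → Fin n → ℚ) :
    permTriple p (r • v) = r • permTriple p v := rfl

theorem permPair_mul (p q : Equiv.Perm (Fin n)) (v : Fin n → Fin n → ℚ) :
    permPair (p * q) v = permPair p (permPair q v) := rfl

theorem permTriple_mul (p q : Equiv.Perm (Fin n)) (v : Fin n → Fin n → Fin n → ℚ) :
    permTriple (p * q) v = permTriple p (permTriple q v) := rfl

theorem permPair_one (v : Fin n → Fin n → ℚ) : permPair 1 v = v := rfl

theorem permTriple_one (v : Fin n → Fin n → Fin n → ℚ) : permTriple 1 v = v := rfl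

theorem permTriple_bracket (p : Equiv.Perm (Fin n)) (u v : Fin n → Fin n → ℚ) :
    permTriple p (bracket u v) = bracket (permPair p u) (permPair p v) := rfl

theorem permTriple_sum {ι : Type*} (p : Equiv.Perm (Fin n)) (S : Finset ι)
    (f : ι → Fin n → Fin n → Fin n → ℚ) :
    permTriple p (∑ i ∈ S, f i) = ∑ i ∈ S, permTriple p (f i) := by
  funext a b c; simp [permTriple, Finset.sum_apply]

variable (n) in
/-- The semidirect product of the symmetric group and the nilpotent group with the commutator
pairing `2 • bracket`. -/
@[ext]
structure Model where
  /-- the component of degree one -/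
  v : Fin n → Fin n → ℚ
  /-- the component of degree two -/
  w : Fin n → Fin n → Fin n → ℚ
  /-- the permutation -/
  p : Equiv.Perm (Fin n)

namespace Model

instance : Mul (Model n) :=
  ⟨fun x y => ⟨x.v + permPair x.p y.v,
    x.w + permTriple x.p y.w + bracket x.v (permPair x.p y.v), x.p * y.p⟩⟩

instance : One (Model n) := ⟨⟨0, 0, 1⟩⟩

instance : Inv (Model n) := ⟨fun x => ⟨-permPair x.p⁻¹ x.v, -permTriple x.p⁻¹ x.w, x.p⁻¹⟩⟩

theorem mul_v (x y : Model n) : (x * y).v = x.v + permPair x.p y.v := rfl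
theorem mul_w (x y : Model n) :
    (x * y).w = x.w + permTriple x.p y.w + bracket x.v (permPair x.p y.v) := rfl
theorem mul_p (x y : Model n) : (x * y).p = x.p * y.p := rfl
theorem one_v : (1 : Model n).v = 0 := rfl
theorem one_w : (1 : Model n).w = 0 := rfl
theorem one_p : (1 : Model n).p = 1 := rfl
theorem inv_v (x : Model n) : (x⁻¹).v = -permPair x.p⁻¹ x.v := rfl
theorem inv_w (x : Model n) : (x⁻¹).w = -permTriple x.p⁻¹ x.w := rfl
theorem inv_p (x : Model n) : (x⁻¹).p = x.p⁻¹ := rfl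

/-- Associativity rests on the bracket being biadditive and equivariant under permutations. The
inverse needs no bracket term because the bracket of a function with its own negative vanishes. -/
instance : Group (Model n) :=
  Group.ofLeftAxioms
    (fun x y z => by
      ext1
      · simp only [mul_v, mul_p, permPair_add, permPair_mul, add_assoc]
      · simp only [mul_v, mul_w, mul_p, permPair_add, permPair_mul, permTriple_add,
          permTriple_mul, permTriple_bracket, bracket_add_left, bracket_add_right]
        abel
      · simp only [mul_p, mul_assoc])
    (fun x => by
      ext1
      · simp only [mul_v, one_v, one_p, permPair_one, zero_add]
      · funext a b c
        simp [mul_w, one_v, one_w, one_p, permTriple_one, bracket]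
      · simp only [mul_p, one_p, one_mul])
    (fun x => by
      ext1
      · simp only [mul_v, inv_v, inv_p, one_v, neg_add_cancel]
      · funext a b c
        simp only [mul_w, inv_v, inv_w, inv_p, one_w, bracket, Pi.add_apply, Pi.neg_apply,
          Pi.zero_apply]
        ring
      · simp only [mul_p, inv_p, one_p, inv_mul_cancel])

/-- The permutation component, as a homomorphism. -/
def permPart : Model n →* Equiv.Perm (Fin n) := ⟨⟨Model.p, rfl⟩, fun _ _ => rfl⟩

theorem conj_v {g x : Model n} (hx : x.p = 1) : (g * x * g⁻¹).v = permPair g.p x.v := by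
  rw [mul_v, mul_v, mul_p, hx, inv_v, permPair_neg, mul_one, ← permPair_mul, mul_inv_cancel,
    permPair_one]
  abel

theorem commutator_p {x y : Model n} (hx : x.p = 1) (hy : y.p = 1) : ⁅x, y⁆.p = 1 := by
  simp [commutatorElement_def, mul_p, inv_p, hx, hy]

theorem commutator_v {x y : Model n} (hx : x.p = 1) (hy : y.p = 1) : ⁅x, y⁆.v = 0 := by
  simp only [commutatorElement_def, mul_v, mul_p, inv_v, inv_p, hx, hy, mul_one, inv_one,
    permPair_one]
  abel

theorem commutator_w {x y : Model n} (hx : x.p = 1) (hy : y.p = 1) :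
    ⁅x, y⁆.w = (2 : ℚ) • bracket x.v y.v := by
  funext a b c
  simp only [commutatorElement_def, mul_v, mul_w, mul_p, inv_v, inv_w, inv_p, hx, hy, mul_one,
    inv_one, permPair_one, permTriple_one, bracket, Pi.add_apply, Pi.neg_apply, Pi.smul_apply,
    smul_eq_mul]
  ring

theorem classTwo_ker : ClassTwo (permPart (n := n)).ker := by
  intro x hx y hy z hz
  have hx : x.p = 1 := hx
  have hy : y.p = 1 := hy
  have hz : z.p = 1 := hz
  rw [← commutatorElement_eq_one_iff_commute]
  have h := commutator_p hx hy
  ext1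
  · exact commutator_v h hz
  · rw [commutator_w h hz, commutator_v hx hy]
    funext a b c; simp [bracket, one_w]
  · exact commutator_p h hz

end Model

/-- The characteristic function of an unordered pair. -/
def pairFun (i j : Fin n) : Fin n → Fin n → ℚ :=
  fun a b => if (a = i ∧ b = j) ∨ (a = j ∧ b = i) then 1 else 0

/-- The alternating function supported on the orderings of a triple. -/
def tripleFun (i j k : Fin n) : Fin n → Fin n → Fin n → ℚ := bracket (pairFun i j) (pairFun j k)

theorem pairFun_comm (i j : Fin n) : pairFun j i = pairFun i j := by
  funext a b; simp only [pairFun, or_comm]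

theorem pairFun_swap (i j a b : Fin n) : pairFun i j b a = pairFun i j a b := by
  simp only [pairFun, and_comm, or_comm]

theorem permPair_pairFun (p : Equiv.Perm (Fin n)) (i j : Fin n) :
    permPair p (pairFun i j) = pairFun (p i) (p j) := by
  funext a b; simp only [permPair, pairFun, Equiv.Perm.inv_eq_iff_eq]

theorem permTriple_tripleFun (p : Equiv.Perm (Fin n)) (i j k : Fin n) :
    permTriple p (tripleFun i j k) = tripleFun (p i) (p j) (p k) := by
  rw [tripleFun, permTriple_bracket, permPair_pairFun, permPair_pairFun, tripleFun]

/-- Each term of the bracket multiplies values at two pairs with a common point, and disjoint pairs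
have no common point. -/
theorem bracket_disjoint {i j k l : Fin n} (hik : i ≠ k) (hil : i ≠ l) (hjk : j ≠ k)
    (hjl : j ≠ l) : bracket (pairFun i j) (pairFun k l) = 0 := by
  have key : ∀ a b c, pairFun i j a b * pairFun k l b c = 0 := by
    intro a b c
    unfold pairFun
    split_ifs with h1 h2 <;> simp
    rcases h1 with ⟨rfl, rfl⟩ | ⟨rfl, rfl⟩ <;> simp_all
  funext a b c
  simp only [bracket, Pi.zero_apply]
  have h1 := key a b c
  have h2 := key c b a
  have h3 := key b c a
  have h4 := key a c b
  have h5 := key c a b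
  have h6 := key b a c
  simp only [pairFun_swap i j a b, pairFun_swap i j b c, pairFun_swap i j c a,
    pairFun_swap k l a b, pairFun_swap k l b c, pairFun_swap k l c a] at *
  linarith

/-- `pairFun i k + pairFun j k` is symmetric in `i` and `j`, hence has zero bracket with `pairFun i
j`. This is the linear counterpart of `commute_artinA_triangle`. -/
theorem tripleFun_swap_left {i j k : Fin n} (hij : i ≠ j) (hik : i ≠ k) (hjk : j ≠ k) :
    tripleFun j i k = -tripleFun i j k := by
  have key : ∀ a b c, pairFun i j a b * (pairFun i k a c + pairFun j k a c) =
      pairFun i j a b * (pairFun i k b c + pairFun j k b c) := by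
    intro a b c
    by_cases h : (a = i ∧ b = j) ∨ (a = j ∧ b = i)
    · rcases h with ⟨rfl, rfl⟩ | ⟨rfl, rfl⟩ <;> simp [pairFun, hij, hik, hjk, hij.symm]
    · simp [pairFun, h]
  funext a b c
  have h1 := key a b c
  have h2 := key b c a
  have h3 := key c a b
  rw [tripleFun, tripleFun, pairFun_comm i j]
  simp only [bracket, Pi.neg_apply]
  simp only [pairFun_swap _ _ a b, pairFun_swap _ _ b c, pairFun_swap _ _ c a] at *
  linarith

theorem tripleFun_reverse (i j k : Fin n) : tripleFun k j i = -tripleFun i j k := by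
  rw [tripleFun, tripleFun, bracket_swap, pairFun_comm j k, pairFun_comm i j]

theorem tripleFun_swap_right {i j k : Fin n} (hij : i ≠ j) (hik : i ≠ k) (hjk : j ≠ k) :
    tripleFun i k j = -tripleFun i j k := by
  rw [tripleFun_reverse j k i, tripleFun_swap_left hjk.symm hik.symm hij.symm,
    tripleFun_reverse i j k]
  simp

theorem pairFun_apply {i j a b : Fin n} (hij : i < j) (hab : a < b) :
    pairFun i j a b = if i = a ∧ j = b then 1 else 0 := by
  unfold pairFun
  congr 1
  apply propext
  constructor
  · rintro (⟨rfl, rfl⟩ | ⟨rfl, rfl⟩)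
    · exact ⟨rfl, rfl⟩
    · exact absurd hab (not_lt.2 hij.le)
  · rintro ⟨rfl, rfl⟩; exact Or.inl ⟨rfl, rfl⟩

/-- Evaluation at increasing triples is dual to the functions `tripleFun`; this separates the
`α_{r,s,t}`. -/
theorem tripleFun_apply {i j k a b c : Fin n} (hij : i < j) (hjk : j < k) (hab : a < b)
    (hbc : b < c) : tripleFun i j k a b c = if i = a ∧ j = b ∧ k = c then 1 else 0 := by
  have hac := hab.trans hbc
  simp only [tripleFun, bracket]
  rw [pairFun_swap i j a c, pairFun_swap j k a c, pairFun_apply hij hab, pairFun_apply hij hbc,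
    pairFun_apply hij hac, pairFun_apply hjk hab, pairFun_apply hjk hbc, pairFun_apply hjk hac]
  by_cases h1 : i = a <;> by_cases h2 : j = b <;> by_cases h3 : k = c <;>
    simp [*] <;> grind

end Model

/-! ### The Artin generators and the pure braids in the model -/

section Model

variable {n : ℕ}

/-- The sum of the triples `(a, i, j)` over all `a` below the strand `x`. -/
def sumTriple (x i j : Fin n) : Fin n → Fin n → Fin n → ℚ :=
  ∑ a ∈ Finset.univ.filter (· < x), tripleFun a i j

theorem permTriple_sumTriple (p : Equiv.Perm (Fin n)) {x : Fin n} (hp : ∀ a, p a < x ↔ a < x)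
    (i j : Fin n) : permTriple p (sumTriple x i j) = sumTriple x (p i) (p j) := by
  rw [sumTriple, sumTriple, permTriple_sum]
  simp only [permTriple_tripleFun]
  exact Finset.sum_equiv p (by simp [hp]) (fun _ _ => rfl)

theorem sumTriple_succ {x y : Fin n} (hxy : y.val = x.val + 1) (i j : Fin n) :
    sumTriple y i j = sumTriple x i j + tripleFun x i j := by
  have : Finset.univ.filter (· < y) = insert x (Finset.univ.filter (· < x)) := by
    ext a; simp only [Finset.mem_filter, Finset.mem_univ, true_and, Finset.mem_insert,
      Fin.ext_iff, Fin.lt_def]; omega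
  rw [sumTriple, this, Finset.sum_insert (by simp), add_comm, sumTriple]

/-- The element of the model for which an Artin generator stands. -/
def modelSigma (k : Fin (n - 1)) : Model n :=
  -- Without the triple term the braid relation fails. With coefficient `c`, the two sides contain
  -- `2c + 1` and `-c - 1` times the function of the three strands involved, which forces `c =
  -- -2/3`.
  ⟨pairFun (lo k) (hi k), (-(2 / 3) : ℚ) • sumTriple (lo k) (lo k) (hi k), adjSwap k⟩

theorem adjSwap_lo (k : Fin (n - 1)) : adjSwap k (lo k) = hi k := Equiv.swap_apply_left _ _

theorem adjSwap_hi (k : Fin (n - 1)) : adjSwap k (hi k) = lo k := Equiv.swap_apply_right _ _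

theorem adjSwap_of_ne {k : Fin (n - 1)} {a : Fin n} (h1 : a.val ≠ k.val)
    (h2 : a.val ≠ k.val + 1) : adjSwap k a = a :=
  Equiv.swap_apply_of_ne_of_ne (fun h => h1 (congrArg Fin.val h))
    (fun h => h2 (congrArg Fin.val h))

theorem adjSwap_lt_iff {k : Fin (n - 1)} {x : Fin n} (h : x.val ≤ k.val ∨ k.val + 2 ≤ x.val)
    (a : Fin n) : adjSwap k a < x ↔ a < x := by
  rw [Fin.lt_def, Fin.lt_def, adjSwap_val, natSwap]
  split_ifs <;> omega

theorem modelSigma_comm (i j : Fin (n - 1)) (h : i.val + 2 ≤ j.val) :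
    modelSigma i * modelSigma j = modelSigma j * modelSigma i := by
  have e1 : adjSwap i (lo j) = lo j :=
    adjSwap_of_ne (by simp only [lo]; omega) (by simp only [lo]; omega)
  have e2 : adjSwap i (hi j) = hi j :=
    adjSwap_of_ne (by simp only [hi]; omega) (by simp only [hi]; omega)
  have e3 : adjSwap j (lo i) = lo i :=
    adjSwap_of_ne (by simp only [lo]; omega) (by simp only [lo]; omega)
  have e4 : adjSwap j (hi i) = hi i :=
    adjSwap_of_ne (by simp only [hi]; omega) (by simp only [hi]; omega)
  have b : bracket (pairFun (lo i) (hi i)) (pairFun (lo j) (hi j)) = 0 := by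
    apply bracket_disjoint <;> simp only [lo, hi, ne_eq, Fin.mk.injEq] <;> omega
  ext1
  · simp only [Model.mul_v, modelSigma, permPair_pairFun, e1, e2, e3, e4, add_comm]
  · simp only [Model.mul_w, modelSigma, permPair_pairFun, permTriple_smul]
    rw [permTriple_sumTriple _ (adjSwap_lt_iff (by simp only [lo]; omega)),
      permTriple_sumTriple _ (adjSwap_lt_iff (by simp only [lo]; omega))]
    simp only [e1, e2, e3, e4]
    rw [bracket_swap (pairFun (lo i) (hi i)), b]
    module
  · exact adjSwap_comm i j h

/-- The sum for the upper generator is the sum over the strands below `x` plus the term of `x`. Both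
transpositions permute the sums below `x`, which then agree on the two sides; the choice of
coefficient balances the multiples of `tripleFun x y z`. -/
theorem modelSigma_braid (i j : Fin (n - 1)) (h : j.val = i.val + 1) :
    modelSigma j * modelSigma i * modelSigma j = modelSigma i * modelSigma j * modelSigma i := by
  obtain ⟨x, hx⟩ : ∃ x, x = lo i := ⟨_, rfl⟩
  obtain ⟨y, hy⟩ : ∃ y, y = hi i := ⟨_, rfl⟩
  obtain ⟨z, hz⟩ : ∃ z, z = hi j := ⟨_, rfl⟩
  have hy' : lo j = y := by rw [hy]; simp [lo, hi, h]
  have vx : x.val = i.val := by rw [hx]; rfl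
  have vy : y.val = i.val + 1 := by rw [hy]; rfl
  have vz : z.val = i.val + 2 := by rw [hz]; simp [hi, h]
  have hxy : x ≠ y := fun e => by have := congrArg Fin.val e; omega
  have hxz : x ≠ z := fun e => by have := congrArg Fin.val e; omega
  have hyz : y ≠ z := fun e => by have := congrArg Fin.val e; omega
  have ix : adjSwap i x = y := by rw [hx, hy, adjSwap_lo]
  have iy : adjSwap i y = x := by rw [hx, hy, adjSwap_hi]
  have iz : adjSwap i z = z := adjSwap_of_ne (by omega) (by omega)
  have jx : adjSwap j x = x := adjSwap_of_ne (by omega) (by omega)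
  have jy : adjSwap j y = z := by rw [hz, ← hy', adjSwap_lo]
  have jz : adjSwap j z = y := by rw [hz, ← hy', adjSwap_hi]
  have si (a b : Fin n) : permTriple (adjSwap i) (sumTriple x a b) =
      sumTriple x (adjSwap i a) (adjSwap i b) :=
    permTriple_sumTriple _ (adjSwap_lt_iff (by omega)) a b
  have sj (a b : Fin n) : permTriple (adjSwap j) (sumTriple x a b) =
      sumTriple x (adjSwap j a) (adjSwap j b) :=
    permTriple_sumTriple _ (adjSwap_lt_iff (by omega)) a b
  have t1 : tripleFun z x y = tripleFun x y z := by
    rw [tripleFun_swap_left hxz hxy hyz.symm, tripleFun_swap_right hxy hxz hyz, neg_neg]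
  have b1 : bracket (pairFun x y) (pairFun y z) = tripleFun x y z := rfl
  have b2 : bracket (pairFun x y) (pairFun x z) = -tripleFun x y z := by
    rw [← tripleFun_swap_left hxy hxz hyz, tripleFun, pairFun_comm x y]
  have b3 : bracket (pairFun x z) (pairFun y z) = -tripleFun x y z := by
    rw [← tripleFun_swap_right hxy hxz hyz, tripleFun, pairFun_comm z y]
  have b4 := bracket_swap (pairFun x y) (pairFun y z)
  have b5 := bracket_swap (pairFun x y) (pairFun x z)
  have b6 := bracket_swap (pairFun x z) (pairFun y z)
  rw [b1] at b4
  rw [b2] at b5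
  rw [b3] at b6
  ext1
  · simp only [Model.mul_v, Model.mul_p, modelSigma, permPair_pairFun, Equiv.Perm.mul_apply,
      ← hx, ← hy, ← hz, hy', ix, iy, iz, jx, jy, jz]
    abel
  · simp only [Model.mul_v, Model.mul_w, Model.mul_p, modelSigma, permPair_pairFun,
      permTriple_smul, permTriple_mul, permTriple_add, sumTriple_succ (vy.trans (by rw [vx])),
      permTriple_tripleFun, si, sj, Equiv.Perm.mul_apply, bracket_add_left,
      ← hx, ← hy, ← hz, hy', ix, iy, iz, jx, jy, jz, b1, b2, b3, b4, b5, b6,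
      tripleFun_swap_left hxy hxz hyz, t1]
    module
  · exact adjSwap_braid i j h

variable (n) in
/-- The homomorphism from the braid group to the model. -/
def modelHom : BraidGroup n →* Model n :=
  PresentedGroup.toGroup (f := modelSigma) (by
    rintro w ⟨u, v, h, rfl⟩
    cases h with
    | comm i j h => simp [modelSigma_comm i j h]
    | braid i j h => simp [modelSigma_braid i j h])

theorem modelHom_sigma (k : Fin (n - 1)) : modelHom n (sigma k) = modelSigma k := by
  simp [modelHom, sigma]

theorem modelHom_p (g : BraidGroup n) : (modelHom n g).p = permHom n g := by
  have : Model.permPart.comp (modelHom n) = permHom n := by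
    refine PresentedGroup.ext fun k => ?_
    change Model.permPart (modelHom n (sigma k)) = permHom n (sigma k)
    rw [modelHom_sigma, permHom_sigma]; rfl
  exact DFunLike.congr_fun this g

theorem modelHom_p_eq_one {g : BraidGroup n} (hg : g ∈ pureBraid n) : (modelHom n g).p = 1 := by
  rw [modelHom_p]; exact hg

/-- Pure braids land in the kernel of the permutation part, which has class two. -/
theorem modelHom_gammaThree {g : BraidGroup n} (hg : g ∈ gammaThree n) : modelHom n g = 1 := by
  have h := Subgroup.map_lowerCentralSeries (pureBraid n) (modelHom n) 2
  have hc : ClassTwo ((pureBraid n).map (modelHom n)) := by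
    rintro _ ⟨x, hx, rfl⟩ _ ⟨y, hy, rfl⟩ _ ⟨z, hz, rfl⟩
    exact Model.classTwo_ker _ (modelHom_p_eq_one hx) _ (modelHom_p_eq_one hy) _
      (modelHom_p_eq_one hz)
  rw [classTwo_iff_lowerCentralSeries.1 hc] at h
  exact (Subgroup.mem_bot).1 (h ▸ ⟨g, hg, rfl⟩)

theorem modelHom_pureA_v (i j : Fin n) (h : i < j) :
    (modelHom n (pureA i j h)).v = (2 : ℚ) • pairFun i j := by
  obtain ⟨j, hj⟩ := j
  have hij : i.val < j := h
  change (modelHom n (braidAux i.val j h hj)).v = _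
  rw [braidAux_eq]
  clear h
  induction j, hij using Nat.le_induction with
  | base =>
    have e : natSigma n i.val = sigma ⟨i.val, by omega⟩ := natSigma_val ⟨i.val, by omega⟩
    rw [artinA_self, e, map_pow, modelHom_sigma, sq, Model.mul_v]
    simp only [modelSigma, permPair_pairFun, adjSwap_lo, adjSwap_hi]
    rw [pairFun_comm (lo _) (hi _), two_smul]
    rfl
  | succ j hij ih =>
    have e : natSigma n j = sigma ⟨j, by omega⟩ := natSigma_val ⟨j, by omega⟩
    have hp : artinA (natSigma n) i j ∈ pureBraid n := by
      rw [← braidAux_eq i j hij (by omega)]; exact braidAux_mem _ _ _ _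
    rw [artinA_succ _ hij, map_mul, map_mul, map_inv, Model.conj_v (modelHom_p_eq_one hp),
      ih (by omega), permPair_smul, permPair_pairFun, modelHom_p, e, permHom_sigma,
      adjSwap_of_ne (by simp only []; omega) (by simp only []; omega)]
    congr 2
    exact adjSwap_lo ⟨j, by omega⟩

theorem modelHom_pureAlpha_v (r s t : Fin n) (hrs : r < s) (hst : s < t) :
    (modelHom n (pureAlpha r s t hrs hst)).v = 0 := by
  have e : (pureAlpha r s t hrs hst : BraidGroup n) =
    ⁅(pureA r s hrs : BraidGroup n), (pureA s t hst : BraidGroup n)⁆ := rfl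
  rw [e, map_commutatorElement]
  exact Model.commutator_v (modelHom_p_eq_one (pureA r s hrs).2) (modelHom_p_eq_one (pureA s t hst).2)

/-- The factor 8 is the 2 of `commutator_w` times a 2 from each `A`; what matters later is that it
is nonzero. -/
theorem modelHom_pureAlpha_w (r s t : Fin n) (hrs : r < s) (hst : s < t) :
    (modelHom n (pureAlpha r s t hrs hst)).w = (8 : ℚ) • tripleFun r s t := by
  have e : (pureAlpha r s t hrs hst : BraidGroup n) =
    ⁅(pureA r s hrs : BraidGroup n), (pureA s t hst : BraidGroup n)⁆ := rfl
  rw [e, map_commutatorElement, Model.commutator_w (modelHom_p_eq_one (pureA r s hrs).2)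
    (modelHom_p_eq_one (pureA s t hst).2), modelHom_pureA_v, modelHom_pureA_v, bracket_smul_left,
    bracket_smul_right, smul_smul, smul_smul, tripleFun]
  norm_num

end Model

/-! ### Generators and relations in the quotients -/

section Presentation

variable {n : ℕ}

/-- The hypotheses make the preimage of the closure a normal subgroup containing every `σ_k²`, so
`pureBraid_le` applies. -/
theorem map_pureBraid_le (hn : 0 < n) {G : Type*} [Group G] (φ : BraidGroup n →* G) (Y : Set G)
    (h₁ : ∀ k, ∀ y ∈ Y, φ (sigma k) * y * (φ (sigma k))⁻¹ ∈ Subgroup.closure Y)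
    (h₂ : ∀ k, φ (sigma k) ^ 2 ∈ Subgroup.closure Y) {g : BraidGroup n} (hg : g ∈ pureBraid n) :
    φ g ∈ Subgroup.closure Y := by
  have hσ : ∀ k, ∀ y ∈ Subgroup.closure Y,
      φ (sigma k) * y * (φ (sigma k))⁻¹ ∈ Subgroup.closure Y := by
    intro k y hy
    induction hy using Subgroup.closure_induction with
    | mem y hy => exact h₁ k y hy
    | one => simp
    | mul y z _ _ hy hz => rw [← conj_mul]; exact mul_mem hy hz
    | inv y _ hy => rw [← conj_inv]; exact inv_mem hy
  have hB : ∀ x, (∀ y ∈ Subgroup.closure Y, φ x * y * (φ x)⁻¹ ∈ Subgroup.closure Y) ∧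
      ∀ y ∈ Subgroup.closure Y, (φ x)⁻¹ * y * φ x ∈ Subgroup.closure Y := by
    intro x
    induction x using braid_induction with
    | one => simp
    | mul x z hx hz =>
      constructor
      · intro y hy
        have := hx.1 _ (hz.1 y hy)
        rw [map_mul]
        convert this using 1
        group
      · intro y hy
        have := hz.2 _ (hx.2 y hy)
        rw [map_mul]
        convert this using 1
        group
    | inv x hx =>
      simp only [map_inv, inv_inv]
      exact ⟨hx.2, hx.1⟩
    | gen k =>
      refine ⟨hσ k, fun y hy => ?_⟩
      -- Conjugation by the inverse comes from `σ⁻¹ y σ = σ⁻² (σ y σ⁻¹) σ²`.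
      have := mul_mem (mul_mem (inv_mem (h₂ k)) (hσ k y hy)) (h₂ k)
      convert this using 1
      rw [sq]; group
  have : ((Subgroup.closure Y).comap φ).Normal :=
    ⟨fun y hy x => by
      rw [Subgroup.mem_comap, map_mul, map_mul, map_inv]
      exact (hB x).1 _ hy⟩
  exact pureBraid_le hn ((Subgroup.closure Y).comap φ)
    (fun k => by rw [Subgroup.mem_comap, map_pow]; exact h₂ k) hg

variable (n) in
/-- The evaluation of words in the `A_{i,j}` and `α_{r,s,t}` in `B_n / Γ₃(P_n)`. -/
def evalPure : FreeGroup (PureGen n) →* BraidQuotient n :=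
  FreeGroup.lift fun g => (QuotientGroup.mk (g.elt : BraidGroup n))

theorem evalPure_wA (i j : Fin n) (h : i < j) : evalPure n (wA i j h) = barA i j := by
  rw [evalPure, wA, FreeGroup.lift_apply_of]; exact mk_pureA i j h

theorem evalPure_wAlpha (r s t : Fin n) (hrs : r < s) (hst : s < t) :
    evalPure n (wAlpha r s t hrs hst) = barAlpha r s t := by
  rw [evalPure, wAlpha, FreeGroup.lift_apply_of]; exact mk_pureAlpha r s t hrs hst

theorem evalPure_rel {u v : FreeGroup (PureGen n)} (h : PureRel n u v) :
    evalPure n u = evalPure n v := by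
  have hP := classTwo_barP n
  cases h with
  | alpha_alpha r s t r' s' t' hrs hst hrs' hst' =>
    simp only [map_mul, evalPure_wAlpha]
    exact hP.commute (barAlpha_mem hrs.ne hst.ne)
      (Subgroup.commutator_le_self _ (barAlpha_mem hrs'.ne hst'.ne))
  | alpha_A r s t i j hrs hst hij =>
    simp only [map_mul, evalPure_wAlpha, evalPure_wA]
    exact hP.commute (barAlpha_mem hrs.ne hst.ne) (barA_mem hij.ne)
  | chain i j m hij hjm =>
    simp only [map_commutatorElement, evalPure_wAlpha, evalPure_wA]; rfl
  | left i j m hij hjm =>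
    simp only [map_commutatorElement, map_inv, evalPure_wAlpha, evalPure_wA]
    exact commutator_barA_triangle hij.ne (hij.trans hjm).ne hjm.ne
  | right i l m hil hlm =>
    simp only [map_commutatorElement, map_inv, evalPure_wAlpha, evalPure_wA]
    rw [← barAlpha_swap_right hil.ne (hil.trans hlm).ne hlm.ne, barAlpha, barA_comm l]
  | trivial i j l m hij hlm hc =>
    simp only [map_commutatorElement, map_one, evalPure_wA]
    rcases hc with hc | hc
    · have e : ({i, j} : Finset (Fin n)) = {i, j, l, m} :=
        Finset.eq_of_subset_of_card_le (by intro x; simp; tauto)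
          (by rw [hc, Finset.card_pair hij.ne])
      have hl : l ∈ ({i, j} : Finset (Fin n)) := by rw [e]; simp
      have hm : m ∈ ({i, j} : Finset (Fin n)) := by rw [e]; simp
      simp only [Finset.mem_insert, Finset.mem_singleton] at hl hm
      obtain ⟨rfl, rfl⟩ : l = i ∧ m = j := by omega
      exact commutatorElement_self _
    · have h3 : ∀ a b c : Fin n, ({i, j, l, m} : Finset (Fin n)) ≠ {a, b, c} := by
        intro a b c h
        have := Finset.card_le_three (a := a) (b := b) (c := c)
        rw [← h, hc] at this; omega
      refine commutator_barA_disjoint hij.ne ?_ ?_ ?_ ?_ hlm.ne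
      · rintro rfl; exact h3 i j m (by ext; simp; tauto)
      · rintro rfl; exact h3 i j l (by ext; simp; tauto)
      · rintro rfl; exact h3 i j m (by ext; simp)
      · rintro rfl; exact h3 i j l (by ext; simp; tauto)

theorem barSigma_conj_barA (k : Fin (n - 1)) {i j : Fin n} (hij : i < j)
    (h₁ : ¬ (j = hi k ∧ i < lo k)) (h₂ : i ≠ hi k) :
    barSigma k * barA i j * (barSigma k)⁻¹ = barA (adjSwap k i) (adjSwap k j) := by
  have h := (isArtin_natSigma n).conj_artinA_other hij (by omega) k.isLt
    (fun h => h₁ ⟨Fin.ext h.1, h.2⟩) (fun h => h₂ (Fin.ext h))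
  rw [← symA_of_lt _ hij, natSigma_val, ← adjSwap_val, ← adjSwap_val] at h
  exact congrArg QuotientGroup.mk h

theorem barSigma_sq (k : Fin (n - 1)) : barSigma k ^ 2 = barA (lo k) (hi k) := by
  rw [barA, symA_of_lt _ (show (lo k).val < (hi k).val from Nat.lt_succ_self k.val)]
  change _ = (QuotientGroup.mk (artinA (natSigma n) k.val (k.val + 1)) : BraidQuotient n)
  rw [artinA_self, natSigma_val]; rfl

theorem conj_barA_barA {i j m : Fin n} (hij : i ≠ j) (hjm : j ≠ m) :
    barA j m * barA i j * (barA j m)⁻¹ = barA i j * (barAlpha i j m)⁻¹ := by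
  have h : Commute (barAlpha i j m)⁻¹ (barA i j) :=
    ((classTwo_barP n).commute (barAlpha_mem hij hjm) (barA_mem hij)).inv_left
  rw [← h.eq, barAlpha, commutatorElement_inv, commutatorElement_def]
  group

/-- Since `A_{i,k+1} = σ_k A_{i,k} σ_k⁻¹`, a further conjugation by `σ_k` is conjugation of
`A_{i,k}` by `σ_k² = A_{k,k+1}`. -/
theorem barSigma_conj_barA_right (k : Fin (n - 1)) {i : Fin n} (hi₂ : i < lo k) :
    barSigma k * barA i (hi k) * (barSigma k)⁻¹ =
      barA i (lo k) * (barAlpha i (lo k) (hi k))⁻¹ := by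
  have hk : lo k < hi k := Nat.lt_succ_self k.val
  rw [← conj_barA_barA hi₂.ne hk.ne, ← barSigma_sq]
  have e : barA i (hi k) = barSigma k * barA i (lo k) * (barSigma k)⁻¹ := by
    rw [barSigma_conj_barA k hi₂ (fun h => hk.ne h.1) (hi₂.trans hk).ne, adjSwap_lo,
      show adjSwap k i = i from Equiv.swap_apply_of_ne_of_ne hi₂.ne (hi₂.trans hk).ne]
  rw [e, sq]; group

theorem barSigma_conj_barA_left (k : Fin (n - 1)) {j : Fin n} (hj₁ : hi k < j) :
    barSigma k * barA (hi k) j * (barSigma k)⁻¹ =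
      barA (lo k) j * (barAlpha (lo k) (hi k) j)⁻¹ := by
  have hk : lo k < hi k := Nat.lt_succ_self k.val
  have h2 := hk.trans hj₁
  -- The index is rotated to `(j, lo k, hi k)`, an even permutation, so that `conj_barA_barA`
  -- applies.
  rw [← barAlpha_swap_left hk.ne h2.ne hj₁.ne, ← inv_inv (barAlpha (hi k) (lo k) j),
    ← barAlpha_reverse, barA_comm (lo k) j,
    ← conj_barA_barA h2.ne' hk.ne, ← barSigma_sq]
  have e : barA (hi k) j = barSigma k * barA j (lo k) * (barSigma k)⁻¹ := by
    rw [barA_comm j, barSigma_conj_barA k h2 (fun h => hj₁.ne' h.1) hk.ne, adjSwap_lo,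
      show adjSwap k j = j from Equiv.swap_apply_of_ne_of_ne h2.ne' hj₁.ne']
  rw [e, sq]; group

variable (n) in
/-- The evaluation of words in all the generators in `B_n / Γ₃(P_n)`. -/
def evalBraid : FreeGroup (BraidGen n) →* BraidQuotient n :=
  FreeGroup.lift fun g => QuotientGroup.mk g.elt

theorem evalBraid_ofPure (u : FreeGroup (PureGen n)) : evalBraid n (ofPure u) = evalPure n u := by
  have : (evalBraid n).comp ofPure = evalPure n := by
    ext g; simp [evalBraid, evalPure, ofPure, BraidGen.elt]
  exact DFunLike.congr_fun this u

theorem evalBraid_ofArtin (u : FreeGroup (Fin (n - 1))) :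
    evalBraid n (ofArtin u) = QuotientGroup.mk (FreeGroup.lift sigma u) := by
  have : (evalBraid n).comp ofArtin = (QuotientGroup.mk' (gammaThree n)).comp
      (FreeGroup.lift sigma) := by
    ext g; simp [evalBraid, ofArtin, BraidGen.elt]
  exact DFunLike.congr_fun this u

theorem evalBraid_bSigma (k : Fin (n - 1)) : evalBraid n (bSigma k) = barSigma k := by
  rw [evalBraid, bSigma, FreeGroup.lift_apply_of]; rfl

theorem evalBraid_bA (i j : Fin n) (h : i < j) : evalBraid n (bA i j h) = barA i j := by
  rw [evalBraid, bA, FreeGroup.lift_apply_of]; exact mk_pureA i j h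

theorem evalBraid_bAsymm (i j : Fin n) (h : i ≠ j) : evalBraid n (bAsymm i j h) = barA i j := by
  unfold bAsymm
  split_ifs
  · exact evalBraid_bA _ _ _
  · rw [evalBraid_bA, barA_comm]

theorem evalBraid_bAlpha (r s t : Fin n) (hrs : r < s) (hst : s < t) :
    evalBraid n (bAlpha r s t hrs hst) = barAlpha r s t := by
  rw [evalBraid, bAlpha, FreeGroup.lift_apply_of]; exact mk_pureAlpha r s t hrs hst

theorem evalBraid_rel {u v : FreeGroup (BraidGen n)} (h : BraidRel n u v) :
    evalBraid n u = evalBraid n v := by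
  cases h with
  | pure u v h => rw [evalBraid_ofPure, evalBraid_ofPure, evalPure_rel h]
  | artin u v h => rw [evalBraid_ofArtin, evalBraid_ofArtin, artinRel_eq h]
  | sigma_sq k h => rw [map_pow, evalBraid_bSigma, evalBraid_bA, barSigma_sq]
  | alpha_keep k r s t hrs hst h₁ h₂ =>
    simp only [map_mul, map_inv, evalBraid_bSigma, evalBraid_bAlpha]
    exact conj_barAlpha k hrs.ne hst.ne
  | alpha_swap_left k r s t hrs hst h₁ h₂ =>
    simp only [map_mul, map_inv, evalBraid_bSigma, evalBraid_bAlpha]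
    rw [conj_barAlpha k hrs.ne hst.ne, barAlpha_swap_left h₁.ne' h₂.ne (h₁.trans h₂).ne, inv_inv]
  | alpha_swap_right k r s t hrs hst h₁ h₂ =>
    simp only [map_mul, map_inv, evalBraid_bSigma, evalBraid_bAlpha]
    rw [conj_barAlpha k hrs.ne hst.ne, barAlpha_swap_right (h₁.trans h₂).ne h₁.ne h₂.ne', inv_inv]
  | A_right k i hi₁ hi₂ hk =>
    simp only [map_mul, map_inv, evalBraid_bSigma, evalBraid_bA, evalBraid_bAlpha]
    exact barSigma_conj_barA_right k hi₂
  | A_left k j hj₁ hj₂ hk =>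
    simp only [map_mul, map_inv, evalBraid_bSigma, evalBraid_bA, evalBraid_bAlpha]
    exact barSigma_conj_barA_left k hj₁
  | A_other k i j hij h₁ h₂ hne =>
    simp only [map_mul, map_inv, evalBraid_bSigma, evalBraid_bA, evalBraid_bAsymm]
    exact barSigma_conj_barA k hij h₁ h₂

theorem lift_relators {X G : Type*} [Group G] {E : FreeGroup X → FreeGroup X → Prop}
    (f : FreeGroup X →* G) (h : ∀ u v, E u v → f u = f v) :
    Subgroup.normalClosure (relators E) ≤ f.ker := by
  refine Subgroup.normalClosure_le_normal ?_
  rintro w ⟨u, v, huv, rfl⟩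
  simp [MonoidHom.mem_ker, h u v huv]

end Presentation

/-! ### Faithfulness of the presentation of `P_n / Γ₃(P_n)` -/

/-- A homomorphism from a free group to a commutative group is trivial on a word in which the
letters with nontrivial image have exponent sum zero, as detected by rational functionals. -/
theorem freeGroup_map_eq_one {X C : Type*} [Group C] (hC : ∀ a b : C, a * b = b * a)
    (f : FreeGroup X →* C) (w : FreeGroup X)
    (h : ∀ x, f (FreeGroup.of x) ≠ 1 → ∃ c : FreeGroup X →* Multiplicative ℚ,
      c (FreeGroup.of x) ≠ 1 ∧ (∀ y, y ≠ x → c (FreeGroup.of y) = 1) ∧ c w = 1) : f w = 1 := by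
  classical
  let _ : CommGroup C := { ‹Group C› with mul_comm := hC }
  let e : FreeGroup X →* Multiplicative (X →₀ ℤ) :=
    FreeGroup.lift fun x => Multiplicative.ofAdd (Finsupp.single x 1)
  let F : (X →₀ ℤ) →+ Additive C :=
    Finsupp.liftAddHom fun x => zmultiplesHom _ (Additive.ofMul (f (FreeGroup.of x)))
  have hf : ∀ u, Additive.ofMul (f u) = F (e u).toAdd := by
    have : f = (AddMonoidHom.toMultiplicativeLeft F).comp e := by
      ext x; simp [e, F]
    intro u
    nth_rewrite 1 [this]; rfl
  have hz : ∀ x, f (FreeGroup.of x) ≠ 1 → (e w).toAdd x = 0 := by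
    intro x hx
    obtain ⟨c, hc, hc', hw⟩ := h x hx
    -- As `c` kills all other letters, it is a nonzero multiple of the exponent sum of `x`.
    have key : ∀ u, (c u).toAdd = ((e u).toAdd x : ℚ) * (c (FreeGroup.of x)).toAdd := by
      intro u
      induction u using FreeGroup.induction_on with
      | C1 => simp
      | of y =>
        by_cases hy : y = x
        · subst hy; simp [e]
        · simp [e, hc' y hy, hy]
      | inv_of y hy => simp only [map_inv, toAdd_inv, hy, Finsupp.neg_apply]; push_cast; ring
      | mul a b ha hb => simp only [map_mul, toAdd_mul, ha, hb, Finsupp.add_apply]; push_cast; ring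
    have := key w
    rw [hw, toAdd_one, eq_comm, mul_eq_zero] at this
    rcases this with h | h
    · exact_mod_cast h
    · exact absurd (toAdd_eq_zero.1 h) hc
  have : F (e w).toAdd = 0 := by
    rw [Finsupp.liftAddHom_apply]
    refine Finset.sum_eq_zero fun x hx => ?_
    by_cases h1 : f (FreeGroup.of x) = 1
    · simp [h1]
    · exact absurd (hz x h1) (Finsupp.mem_support_iff.1 hx)
  exact ofMul_eq_zero.1 ((hf w).trans this)

theorem commutator_le_of_closure {G : Type*} [Group G] (N : Subgroup G) [N.Normal] (S : Set G)
    (hS : Subgroup.closure S = ⊤) (h : ∀ x ∈ S, ∀ y ∈ S, ⁅x, y⁆ ∈ N) :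
    ⁅(⊤ : Subgroup G), ⊤⁆ ≤ N := by
  rw [Subgroup.commutator_le]
  intro x _ y _
  have key : ∀ x y : G, ⁅x, y⁆ ∈ N ↔ Commute (x : G ⧸ N) (y : G ⧸ N) := by
    intro x y
    rw [← QuotientGroup.eq_one_iff, ← commutatorElement_eq_one_iff_commute]
    exact Iff.of_eq (congrArg (· = 1) (map_commutatorElement (QuotientGroup.mk' N) x y))
  rw [key]
  have h0 : ∀ x ∈ Subgroup.closure S, ∀ y ∈ Subgroup.closure S,
      Commute (x : G ⧸ N) (y : G ⧸ N) := by
    intro x hx y hy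
    induction hx, hy using Subgroup.closure_induction₂ with
    | mem x y hx hy => exact (key x y).1 (h x hx y hy)
    | one_left x hx => exact Commute.one_left _
    | one_right x hx => exact Commute.one_right _
    | mul_left x y z hx hy hz h1 h2 => exact h1.mul_left h2
    | mul_right y z x hy hz hx h1 h2 => exact h1.mul_right h2
    | inv_left x y hx hy h1 => exact h1.inv_left
    | inv_right x y hx hy h1 => exact h1.inv_right
  exact h0 x (hS ▸ Subgroup.mem_top x) y (hS ▸ Subgroup.mem_top y)

section PurePresented

variable {n : ℕ}

variable (n) in
/-- The group with the presentation of `P_n / Γ₃(P_n)`. -/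
abbrev PurePresented : Type := PresentedGroup (relators (PureRel n))

variable (n) in
/-- The map from words to the presented group. -/
def pureMk : FreeGroup (PureGen n) →* PurePresented n := PresentedGroup.mk _

theorem pureMk_rel {u v : FreeGroup (PureGen n)} (h : PureRel n u v) : pureMk n u = pureMk n v :=
  PresentedGroup.mk_eq_mk_of_mul_inv_mem ⟨u, v, h, rfl⟩

theorem pureMk_wAlpha_mem_center (r s t : Fin n) (hrs : r < s) (hst : s < t) :
    pureMk n (wAlpha r s t hrs hst) ∈ Subgroup.center (PurePresented n) := by
  have : Subgroup.centralizer {pureMk n (wAlpha r s t hrs hst)} = ⊤ := by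
    rw [eq_top_iff]
    intro x _
    refine PresentedGroup.generated_by _ _ (fun g => ?_) x
    rw [Subgroup.mem_centralizer_singleton_iff]
    change pureMk n (FreeGroup.of g) * _ = _ * pureMk n (FreeGroup.of g)
    rw [← map_mul, ← map_mul]
    cases g with
    | A i j h => exact (pureMk_rel (.alpha_A r s t i j hrs hst h)).symm
    | alpha r' s' t' hrs' hst' => exact pureMk_rel (.alpha_alpha r' s' t' r s t hrs' hst' hrs hst)
  rw [Subgroup.mem_center_iff]
  intro x
  exact (Subgroup.mem_centralizer_singleton_iff).1 (this ▸ Subgroup.mem_top x)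

variable (n) in
/-- The subgroup generated by the `α_{r,s,t}` in the presented group. -/
def alphaSubgroup : Subgroup (PurePresented n) :=
  Subgroup.closure {x | ∃ r s t hrs hst, x = pureMk n (wAlpha r s t hrs hst)}

theorem alphaSubgroup_le_center : alphaSubgroup n ≤ Subgroup.center (PurePresented n) := by
  rw [alphaSubgroup, Subgroup.closure_le]
  rintro _ ⟨r, s, t, hrs, hst, rfl⟩
  exact pureMk_wAlpha_mem_center r s t hrs hst

instance : (alphaSubgroup n).Normal :=
  ⟨fun x hx g => by
    rw [Subgroup.mem_center_iff.1 (alphaSubgroup_le_center hx) g, mul_inv_cancel_right]; exact hx⟩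

theorem wAlpha_mem (r s t : Fin n) (hrs : r < s) (hst : s < t) :
    pureMk n (wAlpha r s t hrs hst) ∈ alphaSubgroup n :=
  Subgroup.subset_closure ⟨r, s, t, hrs, hst, rfl⟩

theorem commutator_wA_mem {i j l m : Fin n} (hij : i < j) (hlm : l < m) :
    ⁅pureMk n (wA i j hij), pureMk n (wA l m hlm)⁆ ∈ alphaSubgroup n := by
  have h1 : ∀ i j m (hij : i < j) (hjm : j < m),
      ⁅pureMk n (wA i j hij), pureMk n (wA j m hjm)⁆ ∈ alphaSubgroup n := by
    intro i j m hij hjm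
    rw [← map_commutatorElement, pureMk_rel (.chain i j m hij hjm)]
    exact wAlpha_mem _ _ _ _ _
  have h2 : ∀ i j m (hij : i < j) (hjm : j < m),
      ⁅pureMk n (wA i j hij), pureMk n (wA i m (hij.trans hjm))⁆ ∈ alphaSubgroup n := by
    intro i j m hij hjm
    rw [← map_commutatorElement, pureMk_rel (.left i j m hij hjm), map_inv]
    exact inv_mem (wAlpha_mem _ _ _ _ _)
  have h3 : ∀ i j m (hij : i < j) (hjm : j < m),
      ⁅pureMk n (wA i m (hij.trans hjm)), pureMk n (wA j m hjm)⁆ ∈ alphaSubgroup n := by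
    intro i j m hij hjm
    rw [← map_commutatorElement, pureMk_rel (.right i j m hij hjm), map_inv]
    exact inv_mem (wAlpha_mem _ _ _ _ _)
  have hs : ∀ x y : PurePresented n, ⁅x, y⁆ ∈ alphaSubgroup n → ⁅y, x⁆ ∈ alphaSubgroup n := by
    intro x y h
    rw [← commutatorElement_inv]; exact inv_mem h
  by_cases e1 : i = l
  · subst e1
    rcases lt_trichotomy j m with h | rfl | h
    · exact h2 i j m hij h
    · rw [commutatorElement_self]; exact one_mem _
    · exact hs _ _ (h2 i m j hlm h)
  by_cases e2 : j = m
  · subst e2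
    rcases lt_or_gt_of_ne e1 with h | h
    · exact h3 i l j h hlm
    · exact hs _ _ (h3 l i j h hij)
  by_cases e3 : j = l
  · subst e3; exact h1 i j m hij hlm
  by_cases e4 : m = i
  · subst e4; exact hs _ _ (h1 l m j hlm hij)
  · have hc : ({i, j, l, m} : Finset (Fin n)).card = 4 := by
      have := hij.ne
      have := hlm.ne
      rw [Finset.card_insert_of_notMem, Finset.card_insert_of_notMem, Finset.card_pair hlm.ne] <;>
        simp [*, Ne.symm]
    rw [← map_commutatorElement, pureMk_rel (.trivial i j l m hij hlm (Or.inr hc)), map_one]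
    exact one_mem _

/-- Each commutator of two generators is an `α`, its inverse or 1. Since the `α` are central, the
presented group has class two. -/
theorem commutator_le_alphaSubgroup :
    ⁅(⊤ : Subgroup (PurePresented n)), ⊤⁆ ≤ alphaSubgroup n := by
  refine commutator_le_of_closure _ _ (PresentedGroup.closure_range_of _) ?_
  have hcen : ∀ (r s t : Fin n) hrs hst (x : PurePresented n),
      Commute (pureMk n (wAlpha r s t hrs hst)) x := fun r s t hrs hst x =>
    (Subgroup.mem_center_iff.1 (pureMk_wAlpha_mem_center r s t hrs hst) x).symm
  rintro _ ⟨g, rfl⟩ _ ⟨g', rfl⟩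
  change ⁅pureMk n (FreeGroup.of g), pureMk n (FreeGroup.of g')⁆ ∈ _
  cases g with
  | alpha r s t hrs hst =>
    rw [show FreeGroup.of (PureGen.alpha r s t hrs hst) = wAlpha r s t hrs hst from rfl,
      (hcen r s t hrs hst _).commutator_eq]
    exact one_mem _
  | A i j h =>
    cases g' with
    | alpha r s t hrs hst =>
      rw [show FreeGroup.of (PureGen.alpha r s t hrs hst) = wAlpha r s t hrs hst from rfl,
        (hcen r s t hrs hst _).symm.commutator_eq]
      exact one_mem _
    | A l m h' => exact commutator_wA_mem h h'

theorem classTwo_purePresented : ClassTwo (⊤ : Subgroup (PurePresented n)) := by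
  intro x hx y hy z _
  exact (Subgroup.mem_center_iff.1 (alphaSubgroup_le_center
    (commutator_le_alphaSubgroup (Subgroup.commutator_mem_commutator hx hy))) z).symm

/-! ### Detection of exponents by the model -/

/-- The function on pairs attached to a pure braid, at a given pair, as a homomorphism. -/
def linkHom (a b : Fin n) : pureBraid n →* Multiplicative ℚ :=
  MonoidHom.mk' (fun x => Multiplicative.ofAdd ((modelHom n x).v a b)) (fun x y => by
    rw [Subgroup.coe_mul, map_mul, Model.mul_v, modelHom_p_eq_one x.2, permPair_one]; rfl)

variable (n) in
/-- The evaluation of words in the pure braid group. -/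
def wordPure : FreeGroup (PureGen n) →* pureBraid n := FreeGroup.lift PureGen.elt

/-- In the abelianization the `α` vanish, being commutators. The coordinate `linkHom i j` isolates
the exponent of `A_{i,j}` and vanishes on `Γ₃`. -/
theorem mem_commutator_of_wordPure {w : FreeGroup (PureGen n)}
    (hw : (wordPure n w : BraidGroup n) ∈ gammaThree n) :
    pureMk n w ∈ commutator (PurePresented n) := by
  have : ((Abelianization.of (G := PurePresented n)).comp (pureMk n)) w = 1 := by
    refine freeGroup_map_eq_one mul_comm
      ((Abelianization.of (G := PurePresented n)).comp (pureMk n)) w fun g hg => ?_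
    cases g with
    | alpha r s t hrs hst =>
      refine absurd ?_ hg
      have h := pureMk_rel (.chain r s t hrs hst)
      rw [MonoidHom.comp_apply, show FreeGroup.of (PureGen.alpha r s t hrs hst) =
        wAlpha r s t hrs hst from rfl, ← h, map_commutatorElement, map_commutatorElement]
      exact (Commute.all _ _).commutator_eq
    | A i j h =>
      refine ⟨(linkHom i j).comp (wordPure n), ?_, ?_, ?_⟩
      · simp only [MonoidHom.comp_apply, wordPure, FreeGroup.lift_apply_of, PureGen.elt, linkHom,
          MonoidHom.mk'_apply, modelHom_pureA_v]
        simp [pairFun]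
      · intro g hg
        cases g with
        | alpha r s t hrs hst =>
          simp only [MonoidHom.comp_apply, wordPure, FreeGroup.lift_apply_of, PureGen.elt, linkHom,
            MonoidHom.mk'_apply, modelHom_pureAlpha_v]
          rfl
        | A k l h' =>
          simp only [MonoidHom.comp_apply, wordPure, FreeGroup.lift_apply_of, PureGen.elt, linkHom,
            MonoidHom.mk'_apply, modelHom_pureA_v, Pi.smul_apply]
          rw [pairFun_apply h' h, if_neg, smul_zero, ofAdd_zero]
          rintro ⟨rfl, rfl⟩; exact hg rfl
      · simp only [MonoidHom.comp_apply, linkHom, MonoidHom.mk'_apply, modelHom_gammaThree hw]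
        rfl
  exact (QuotientGroup.eq_one_iff (N := commutator (PurePresented n)) _).1 this

/-- The letters `α_{r,s,t}`, as elements of the centre; the letters `A_{i,j}` are erased. -/
def centralLetter : PureGen n → Subgroup.center (PurePresented n)
  | .A _ _ _ => 1
  | .alpha r s t hrs hst => ⟨_, pureMk_wAlpha_mem_center r s t hrs hst⟩

/-- The words `α_{r,s,t}`; the letters `A_{i,j}` are erased. -/
def alphaLetter : PureGen n → FreeGroup (PureGen n)
  | .A _ _ _ => 1
  | .alpha r s t hrs hst => wAlpha r s t hrs hst

theorem pureMk_alphaLetter (w : FreeGroup (PureGen n)) :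
    pureMk n (FreeGroup.lift alphaLetter w) = FreeGroup.lift centralLetter w := by
  have : (pureMk n).comp (FreeGroup.lift alphaLetter) =
      (Subgroup.center (PurePresented n)).subtype.comp (FreeGroup.lift centralLetter) := by
    ext g; cases g <;> simp [alphaLetter, centralLetter]
  exact DFunLike.congr_fun this w

theorem exists_alphaLetter {x : PurePresented n} (hx : x ∈ alphaSubgroup n) :
    ∃ w, pureMk n (FreeGroup.lift alphaLetter w) = x := by
  have : alphaSubgroup n ≤ ((pureMk n).comp (FreeGroup.lift alphaLetter)).range := by
    rw [alphaSubgroup, Subgroup.closure_le]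
    rintro _ ⟨r, s, t, hrs, hst, rfl⟩
    exact ⟨FreeGroup.of (.alpha r s t hrs hst), by simp [alphaLetter]⟩
  exact this hx

/-- With vanishing pair component the bracket term disappears, so the triple component becomes
additive on such words; `tripleHom` relies on this. -/
theorem wordPure_alphaLetter_v (w : FreeGroup (PureGen n)) :
    (modelHom n (wordPure n (FreeGroup.lift alphaLetter w))).v = 0 := by
  induction w using FreeGroup.induction_on with
  | C1 => simp [Model.one_v]
  | of g =>
    cases g with
    | A i j h => simp [alphaLetter, Model.one_v]
    | alpha r s t hrs hst =>
      simp only [FreeGroup.lift_apply_of, alphaLetter, wAlpha, wordPure, PureGen.elt,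
        modelHom_pureAlpha_v]
  | inv_of g hg =>
    rw [map_inv, map_inv, Subgroup.coe_inv, map_inv, Model.inv_v, hg]
    exact neg_zero
  | mul a b ha hb =>
    rw [map_mul, map_mul, Subgroup.coe_mul, map_mul, Model.mul_v, ha, hb]
    exact add_zero _

/-- The function on triples attached to a word in the `α_{r,s,t}`, at a given triple, as a
homomorphism. -/
def tripleHom (a b c : Fin n) : FreeGroup (PureGen n) →* Multiplicative ℚ :=
  MonoidHom.mk' (fun w => Multiplicative.ofAdd
    ((modelHom n (wordPure n (FreeGroup.lift alphaLetter w))).w a b c)) (fun x y => by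
      rw [map_mul, map_mul, Subgroup.coe_mul, map_mul, Model.mul_w, wordPure_alphaLetter_v,
        modelHom_p_eq_one (wordPure n _).2, permTriple_one]
      have : ∀ u : Fin n → Fin n → ℚ, bracket 0 u = 0 := fun u => by
        funext a b c; simp [bracket]
      rw [this, add_zero]; rfl)

/-- The coordinate `tripleHom r s t` is a nonzero multiple of the exponent sum of `α_{r,s,t}`, so
triviality modulo `Γ₃` makes all these sums zero. -/
theorem centralLetter_eq_one {w : FreeGroup (PureGen n)}
    (hw : (wordPure n (FreeGroup.lift alphaLetter w) : BraidGroup n) ∈ gammaThree n) :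
    FreeGroup.lift centralLetter w = 1 := by
  refine freeGroup_map_eq_one (fun a b => Subtype.ext (Subgroup.mem_center_iff.1 b.2 a))
    (FreeGroup.lift (centralLetter (n := n))) w fun g hg => ?_
  cases g with
  | A i j h => exact absurd (by simp [centralLetter]) hg
  | alpha r s t hrs hst =>
    refine ⟨tripleHom r s t, ?_, ?_, ?_⟩
    · simp only [tripleHom, MonoidHom.mk'_apply, FreeGroup.lift_apply_of, alphaLetter, wAlpha,
        wordPure, PureGen.elt, modelHom_pureAlpha_w, Pi.smul_apply]
      rw [tripleFun_apply hrs hst hrs hst, if_pos ⟨rfl, rfl, rfl⟩]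
      simp
    · intro g hg
      cases g with
      | A i j h =>
        simp only [tripleHom, MonoidHom.mk'_apply, FreeGroup.lift_apply_of, alphaLetter, map_one,
          Subgroup.coe_one]
        rfl
      | alpha r' s' t' hrs' hst' =>
        simp only [tripleHom, MonoidHom.mk'_apply, FreeGroup.lift_apply_of, alphaLetter, wAlpha,
          wordPure, PureGen.elt, modelHom_pureAlpha_w, Pi.smul_apply]
        rw [tripleFun_apply hrs' hst' hrs hst, if_neg, smul_zero, ofAdd_zero]
        rintro ⟨rfl, rfl, rfl⟩; exact hg rfl
    · simp only [tripleHom, MonoidHom.mk'_apply, modelHom_gammaThree hw]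
      rfl

theorem evalPure_eq (w : FreeGroup (PureGen n)) :
    evalPure n w = QuotientGroup.mk (wordPure n w : BraidGroup n) := by
  have : evalPure n = (QuotientGroup.mk' (gammaThree n)).comp
      ((pureBraid n).subtype.comp (wordPure n)) := by
    ext g; simp [evalPure, wordPure]
  exact DFunLike.congr_fun this w

theorem evalPure_eq_of_pureMk {u v : FreeGroup (PureGen n)} (h : pureMk n u = pureMk n v) :
    evalPure n u = evalPure n v := by
  rw [← mul_inv_eq_one, ← map_inv, ← map_mul]
  refine lift_relators (E := PureRel n) (evalPure n) (fun u v => evalPure_rel) ?_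
  rw [← PresentedGroup.mk_eq_one_iff]
  change pureMk n _ = 1
  rw [map_mul, map_inv, h, mul_inv_cancel]

/-- Pair coordinates first put the word in the commutator subgroup, where it equals a word in the
`α`. That word has the same value in the quotient, so triple coordinates make it trivial. -/
theorem pureMk_eq_one {w : FreeGroup (PureGen n)} (hw : evalPure n w = 1) : pureMk n w = 1 := by
  have h := hw
  rw [evalPure_eq, QuotientGroup.eq_one_iff] at h
  obtain ⟨w', hw'⟩ := exists_alphaLetter
    (commutator_le_alphaSubgroup (mem_commutator_of_wordPure h))
  have h' := evalPure_eq_of_pureMk hw'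
  rw [hw, evalPure_eq, QuotientGroup.eq_one_iff] at h'
  rw [← hw', pureMk_alphaLetter, centralLetter_eq_one h']; rfl

theorem pureQuotient_relation_iff (w : FreeGroup (PureGen n)) :
    FreeGroup.lift (fun g : PureGen n => (QuotientGroup.mk g.elt : PureQuotient n)) w = 1 ↔
      evalPure n w = 1 := by
  have : FreeGroup.lift (fun g : PureGen n => (QuotientGroup.mk g.elt : PureQuotient n)) =
      (QuotientGroup.mk' _).comp (wordPure n) := by
    ext g; simp [wordPure]
  rw [this, evalPure_eq, QuotientGroup.eq_one_iff, MonoidHom.comp_apply]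
  exact (QuotientGroup.eq_one_iff _).trans Subgroup.mem_subgroupOf

end PurePresented

/-! ### The two presentations -/

section Main

variable {n : ℕ}

/-- In a group satisfying the relations of the second presentation, pure braids are words in the
`A_{i,j}` and `α_{r,s,t}`. -/
theorem exists_pure_word (hn : 0 < n) {G : Type*} [Group G] (ev : FreeGroup (BraidGen n) →* G)
    (hrel : ∀ u v, BraidRel n u v → ev u = ev v) (φ : BraidGroup n →* G)
    (hφ : ∀ k, φ (sigma k) = ev (bSigma k)) {g : BraidGroup n} (hg : g ∈ pureBraid n) :
    ∃ w, ev (ofPure w) = φ g := by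
  -- The target is kept general because two cases are needed: `B_n/Γ₃(P_n)` gives surjectivity in
  -- (a), and the presented group of (b) gives its class-two property.
  let Y : Set G := Set.range fun x : PureGen n => ev (ofPure (FreeGroup.of x))
  have hA : ∀ i j h, ev (bA i j h) ∈ Subgroup.closure Y := fun i j h =>
    Subgroup.subset_closure ⟨.A i j h, by simp [ofPure, bA]⟩
  have hα : ∀ r s t hrs hst, ev (bAlpha r s t hrs hst) ∈ Subgroup.closure Y :=
    fun r s t hrs hst => Subgroup.subset_closure ⟨.alpha r s t hrs hst, by simp [ofPure, bAlpha]⟩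
  have hAs : ∀ i j h, ev (bAsymm i j h) ∈ Subgroup.closure Y := fun i j h => by
    unfold bAsymm; split_ifs <;> exact hA _ _ _
  have hcA : ∀ k i j h, ev (bSigma k) * ev (bA i j h) * (ev (bSigma k))⁻¹ ∈
      Subgroup.closure Y := by
    intro k i j h
    have hk : lo k < hi k := Nat.lt_succ_self k.val
    rw [← map_inv, ← map_mul, ← map_mul]
    by_cases h1 : j = hi k ∧ i < lo k
    · obtain ⟨rfl, h1⟩ := h1
      rw [hrel _ _ (.A_right k i h h1 hk), map_mul, map_inv]
      exact mul_mem (hA _ _ _) (inv_mem (hα _ _ _ _ _))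
    by_cases h2 : i = hi k
    · subst h2
      rw [hrel _ _ (.A_left k j h (hk.trans h) hk), map_mul, map_inv]
      exact mul_mem (hA _ _ _) (inv_mem (hα _ _ _ _ _))
    · rw [hrel _ _ (.A_other k i j h h1 h2 ((adjSwap k).injective.ne h.ne))]
      exact hAs _ _ _
  have hc : ∀ k, ∀ y ∈ Y, φ (sigma k) * y * (φ (sigma k))⁻¹ ∈ Subgroup.closure Y := by
    rintro k _ ⟨x, rfl⟩
    rw [hφ]
    cases x with
    | A i j h => simpa [ofPure, bA] using hcA k i j h
    | alpha r s t hrs hst =>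
      -- Writing `α` as a commutator of two `A` reduces its conjugates to those of the `A`.
      have e := hrel _ _ (.pure _ _ (.chain r s t hrs hst))
      rw [map_commutatorElement, map_commutatorElement] at e
      change ev (bSigma k) * ev (ofPure (wAlpha r s t hrs hst)) * _ ∈ _
      rw [← e, conjugate_commutatorElement]
      have h1 : ev (ofPure (wA r s hrs)) = ev (bA r s hrs) := by simp [ofPure, wA, bA]
      have h2 : ev (ofPure (wA s t hst)) = ev (bA s t hst) := by simp [ofPure, wA, bA]
      rw [h1, h2]
      exact Subgroup.commutator_le_self _
        (Subgroup.commutator_mem_commutator (hcA k r s hrs) (hcA k s t hst))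
  have h2 : ∀ k, φ (sigma k) ^ 2 ∈ Subgroup.closure Y := fun k => by
    have hk : lo k < hi k := Nat.lt_succ_self k.val
    rw [hφ, ← map_pow, hrel _ _ (.sigma_sq k hk)]
    exact hA _ _ _
  have := map_pureBraid_le hn φ Y hc h2 hg
  rw [← FreeGroup.range_lift_eq_closure] at this
  obtain ⟨w, hw⟩ := this
  refine ⟨w, ?_⟩
  rw [← hw]
  have e : ev.comp ofPure = FreeGroup.lift fun x : PureGen n => ev (ofPure (FreeGroup.of x)) := by
    ext x; simp
  exact DFunLike.congr_fun e w

theorem isPresentation_pure (hn : 0 < n) : IsPresentation (relators (PureRel n))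
    (fun g : PureGen n => (QuotientGroup.mk g.elt : PureQuotient n)) := by
  constructor
  · intro x
    obtain ⟨g, rfl⟩ := QuotientGroup.mk_surjective x
    obtain ⟨w, hw⟩ := exists_pure_word hn (evalBraid n) (fun u v => evalBraid_rel)
      (QuotientGroup.mk' (gammaThree n)) (fun k => (evalBraid_bSigma k).symm) g.2
    refine ⟨w, ?_⟩
    rw [evalBraid_ofPure, evalPure_eq] at hw
    have e : FreeGroup.lift (fun g : PureGen n => (QuotientGroup.mk g.elt : PureQuotient n)) =
        (QuotientGroup.mk' _).comp (wordPure n) := by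
      ext g; simp [wordPure]
    rw [e]
    refine QuotientGroup.eq.2 ?_
    rw [Subgroup.mem_subgroupOf]
    exact QuotientGroup.eq.1 hw
  · ext w
    rw [MonoidHom.mem_ker, pureQuotient_relation_iff, ← PresentedGroup.mk_eq_one_iff]
    refine ⟨pureMk_eq_one, fun h => ?_⟩
    rw [← map_one (evalPure n)]
    exact evalPure_eq_of_pureMk (h.trans (map_one _).symm)

/-! ### The map from the braid group to the presented group of (b) -/

variable (n) in
/-- The group with the presentation of `B_n / Γ₃(P_n)`. -/
abbrev BraidPresented : Type := PresentedGroup (relators (BraidRel n))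

variable (n) in
/-- The map from words to the presented group. -/
def braidMk : FreeGroup (BraidGen n) →* BraidPresented n := PresentedGroup.mk _

theorem braidMk_rel {u v : FreeGroup (BraidGen n)} (h : BraidRel n u v) :
    braidMk n u = braidMk n v :=
  PresentedGroup.mk_eq_mk_of_mul_inv_mem ⟨u, v, h, rfl⟩

variable (n) in
/-- The homomorphism from the braid group to the presented group. -/
def toPresented : BraidGroup n →* BraidPresented n :=
  PresentedGroup.toGroup (f := fun k => braidMk n (bSigma k)) (by
    have e : FreeGroup.lift (fun k => braidMk n (bSigma k)) = (braidMk n).comp ofArtin := by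
      ext k; simp [ofArtin, bSigma]
    rintro w ⟨u, v, h, rfl⟩
    rw [e, map_mul, map_inv, mul_inv_eq_one]
    exact braidMk_rel (.artin u v h))

theorem toPresented_sigma (k : Fin (n - 1)) : toPresented n (sigma k) = braidMk n (bSigma k) := by
  simp [toPresented, sigma]

/-- By `exists_pure_word` the image of `P_n` lies in the image of the class-two group `PurePresented
n`, hence has class two itself. -/
theorem toPresented_gammaThree (hn : 0 < n) {g : BraidGroup n} (hg : g ∈ gammaThree n) :
    toPresented n g = 1 := by
  have hrel : ∀ w ∈ relators (PureRel n),
      FreeGroup.lift (fun x => braidMk n (ofPure (FreeGroup.of x))) w = 1 := by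
    have e : FreeGroup.lift (fun x => braidMk n (ofPure (FreeGroup.of x))) =
        (braidMk n).comp ofPure := by ext x; simp
    rintro w ⟨u, v, h, rfl⟩
    rw [e, map_mul, map_inv, mul_inv_eq_one]
    exact braidMk_rel (.pure u v h)
  let ψ : PurePresented n →* BraidPresented n :=
    PresentedGroup.toGroup hrel
  have hψ : ∀ w, ψ (pureMk n w) = braidMk n (ofPure w) := by
    have e : ψ.comp (pureMk n) = (braidMk n).comp ofPure := by
      ext x
      exact PresentedGroup.toGroup.of hrel
    exact fun w => DFunLike.congr_fun e w
  have hc : ClassTwo ((pureBraid n).map (toPresented n)) := by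
    have hr : ∀ x ∈ (pureBraid n).map (toPresented n), ∃ y, ψ y = x := by
      rintro _ ⟨g, hg, rfl⟩
      obtain ⟨w, hw⟩ := exists_pure_word hn (braidMk n) (fun u v => braidMk_rel) (toPresented n)
        toPresented_sigma hg
      exact ⟨pureMk n w, (hψ w).trans hw⟩
    intro x hx y hy z hz
    obtain ⟨x, rfl⟩ := hr x hx
    obtain ⟨y, rfl⟩ := hr y hy
    obtain ⟨z, rfl⟩ := hr z hz
    rw [← map_commutatorElement]
    exact (classTwo_purePresented x trivial y trivial z trivial).map ψ
  have h := Subgroup.map_lowerCentralSeries (pureBraid n) (toPresented n) 2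
  rw [classTwo_iff_lowerCentralSeries.1 hc] at h
  exact (Subgroup.mem_bot).1 (h ▸ ⟨g, hg, rfl⟩)

/-- The recursion defining `A_{i,j+1}` from `A_{i,j}` is an instance of relation (iv), and its start
is `σ_k² = A_{k,k+1}`. -/
theorem toPresented_pureA (i j : Fin n) (h : i < j) :
    toPresented n (pureA i j h) = braidMk n (bA i j h) := by
  obtain ⟨j, hj⟩ := j
  have hij : i.val < j := h
  change toPresented n (braidAux i.val j h hj) = _
  rw [braidAux_eq]
  induction j, hij using Nat.le_induction with
  | base =>
    have e : natSigma n i.val = sigma ⟨i.val, by omega⟩ := natSigma_val ⟨i.val, by omega⟩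
    rw [artinA_self, e, map_pow, toPresented_sigma, ← map_pow]
    exact braidMk_rel (.sigma_sq ⟨i.val, by omega⟩ h)
  | succ j hij ih =>
    have e : natSigma n j = sigma ⟨j, by omega⟩ := natSigma_val ⟨j, by omega⟩
    have hij' : i.val < j := hij
    rw [artinA_succ _ hij, map_mul, map_mul, map_inv, ih (by omega) hij', e, toPresented_sigma,
      ← map_inv, ← map_mul, ← map_mul]
    let k : Fin (n - 1) := ⟨j, by omega⟩
    have hi' : adjSwap k i = i := adjSwap_of_ne (by simp only [k]; omega) (by simp only [k]; omega)
    have hj' : adjSwap k ⟨j, by omega⟩ = ⟨j + 1, hj⟩ := adjSwap_lo k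
    have hne : adjSwap k i ≠ adjSwap k ⟨j, by omega⟩ := by rw [hi', hj']; exact h.ne
    have hb : bAsymm (adjSwap k i) (adjSwap k ⟨j, by omega⟩) hne = bA i ⟨j + 1, hj⟩ h := by
      simp only [hi', hj']
      rw [bAsymm, dif_pos h]
    rw [← hb]
    refine braidMk_rel (.A_other k i ⟨j, by omega⟩ hij' ?_ ?_ hne)
    · rintro ⟨h1, -⟩
      have := congrArg Fin.val h1
      simp [hi, k] at this
    · intro h1
      have := congrArg Fin.val h1
      simp only [hi, k] at this
      omega

theorem toPresented_pureAlpha (r s t : Fin n) (hrs : r < s) (hst : s < t) :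
    toPresented n (pureAlpha r s t hrs hst) = braidMk n (bAlpha r s t hrs hst) := by
  have e : (pureAlpha r s t hrs hst : BraidGroup n) =
    ⁅(pureA r s hrs : BraidGroup n), (pureA s t hst : BraidGroup n)⁆ := rfl
  have h := braidMk_rel (.pure _ _ (.chain r s t hrs hst))
  rw [map_commutatorElement, map_commutatorElement] at h
  rw [e, map_commutatorElement, toPresented_pureA, toPresented_pureA]
  simpa [ofPure, wA, bA, wAlpha, bAlpha] using h

/-- The formal `A` and `α` agree with the images of the braids they name, so `toPresented` undoes
evaluation. A word whose value lies in `Γ₃(P_n)` is thus trivial in the presented group. -/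
theorem toPresented_lift (w : FreeGroup (BraidGen n)) :
    toPresented n (FreeGroup.lift BraidGen.elt w) = braidMk n w := by
  have e : (toPresented n).comp (FreeGroup.lift BraidGen.elt) = braidMk n := by
    ext x
    rw [MonoidHom.comp_apply, FreeGroup.lift_apply_of]
    cases x with
    | sigma k => exact toPresented_sigma k
    | pure g =>
      cases g with
      | A i j h => exact toPresented_pureA i j h
      | alpha r s t hrs hst => exact toPresented_pureAlpha r s t hrs hst
  exact DFunLike.congr_fun e w

theorem evalBraid_eq (w : FreeGroup (BraidGen n)) :
    evalBraid n w = QuotientGroup.mk (FreeGroup.lift BraidGen.elt w) := by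
  have : evalBraid n = (QuotientGroup.mk' (gammaThree n)).comp (FreeGroup.lift BraidGen.elt) := by
    ext g; simp [evalBraid]
  exact DFunLike.congr_fun this w

theorem isPresentation_braid (hn : 0 < n) : IsPresentation (relators (BraidRel n))
    (fun g : BraidGen n => (QuotientGroup.mk g.elt : BraidQuotient n)) := by
  constructor
  · intro x
    obtain ⟨g, rfl⟩ := QuotientGroup.mk_surjective x
    change (g : BraidQuotient n) ∈ (evalBraid n).range
    induction g using braid_induction with
    | one => exact one_mem _
    | mul x y hx hy => exact mul_mem hx hy
    | inv x hx => exact inv_mem hx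
    | gen k => exact ⟨bSigma k, evalBraid_bSigma k⟩
  · refine le_antisymm (fun w hw => ?_) (lift_relators (evalBraid n) fun u v => evalBraid_rel)
    have h : evalBraid n w = 1 := hw
    rw [evalBraid_eq, QuotientGroup.eq_one_iff] at h
    rw [← PresentedGroup.mk_eq_one_iff]
    exact (toPresented_lift w).symm.trans (toPresented_gammaThree hn h)

end Main

end BraidNil

theorem mainTheorem8 (n : ℕ) (hn : 3 ≤ n) :
    BraidNil.IsPresentation (BraidNil.relators (BraidNil.PureRel n))
      (fun g : BraidNil.PureGen n => (QuotientGroup.mk g.elt : BraidNil.PureQuotient n)) ∧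
    BraidNil.IsPresentation (BraidNil.relators (BraidNil.BraidRel n))
      (fun g : BraidNil.BraidGen n => (QuotientGroup.mk g.elt : BraidNil.BraidQuotient n)) :=
  ⟨BraidNil.isPresentation_pure (by omega), BraidNil.isPresentation_braid (by omega)⟩
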